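/- **Theorem 4.3.** Let $m>0$, $\gamma\in[0,1)$ and $f(x)=e^{-m|x|}|x|^{-\gamma}$ for $x\in\mathbb R$. Put $f^{1\star}=f$, $f^{n\star}(x)=\int_{\mathbb R}f(x-y)f^{(n-1)\star}(y)\,dy$ for $n\ge 2$, and for $\lambda>0$ $$p_\lambda(x)=e^{-\lambda\|f\|_1}\sum_{n=1}^\infty\frac{\lambda^n f^{n\star}(x)}{n!},\qquad \phi(\rho,\beta;t)=\sum_{n=0}^\infty\frac{t^n}{\Gamma(\rho n+\beta)\,n!}\quad(\rho>0,\ \beta\ge 0,\ t>0,\ 1/\Gamma(0):=0).$$ Let $C_1,C_2\ge 1$ be any constants such that $f(x)\le C_1f(y)$ whenever $1\le|x|\le|y|\le|x|+1$, and $f(x)\le C_2f(2x)$ whenever $|x|\le 1$; put $M_2=\max(C_1,C_2)\,\|f\|_1$. Then $\|f\|_1<\infty$, $f^{n\star}(x)$ and $p_\lambda(x)$ are finite for $|x|\ge 1$, and the following hold. (1) For $|x|\ge 1$ and $n\ge 1$, $$\frac{\Gamma(1-\gamma)^n}{\Gamma((1-\gamma)n)}\le\frac{f^{n\star}(x)}{f(x)|x|^{(1-\gamma)(n-1)}}\le\frac{\Gamma(1-\gamma)^n}{\Gamma((1-\gamma)n)}+\frac{2M_2\,n\,(M_2+\Gamma(1-\gamma))^{n-1}}{|x|^{1-\gamma}}.$$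 In particular, for every $n\ge 1$, $$\lim_{|x|\to\infty}\frac{f^{n\star}(x)}{f(x)|x|^{(1-\gamma)(n-1)}}=\lim_{|x|\to\infty}\frac{f^{n\star}(x)}{e^{-m|x|}|x|^{(1-\gamma)n-1}}=\frac{\Gamma(1-\gamma)^n}{\Gamma((1-\gamma)n)}.$$ (2) For $|x|\ge 1$ and $\lambda>0$, $$1\le\frac{p_\lambda(x)}{e^{-\lambda\|f\|_1}e^{-m|x|}|x|^{-1}\,\phi\big(1-\gamma,0;\Gamma(1-\gamma)\lambda|x|^{1-\gamma}\big)}\le e^{M_2\lambda}.$$ In particular, there are positive constants $E_1,E_3,E_4$ depending only on $\gamma$, and a positive constant $E_2$ depending only on $\gamma$ and $m$, such that for all $|x|\ge 1$ and $\lambda>0$: if $\lambda|x|^{1-\gamma}\le 1$, then $$E_1\le\frac{p_\lambda(x)}{\lambda e^{-\lambda\|f\|_1}e^{-m|x|}|x|^{-\gamma}}\le E_2;$$ if $\lambda|x|^{1-\gamma}\ge 1$, then $$E_3\le\frac{p_\lambda(x)}{\lambda^{\frac1{4-2\gamma}}|x|^{-\frac{3-\gamma}{4-2\gamma}}\exp\Big(-\lambda\|f\|_1-m|x|+\frac{2-\gamma}{1-\gamma}\big(\Gamma(2-\gamma)\lambda|x|^{1-\gamma}\big)^{\frac1{2-\gamma}}\Big)}\le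 E_4e^{M_2\lambda}.$$ -/

import Mathlib

open MeasureTheory Filter Topology
open scoped ENNReal Nat

noncomputable section

namespace ExpDensity

/-- The function `f(x) = e^{-m|x|} |x|^{-γ}` on `ℝ`, with values in `[0, ∞]`
(so that `f 0 = ∞` if `γ > 0`, and `f 0 = 1` if `γ = 0`). -/
def expDensity (m γ : ℝ) (x : ℝ) : ℝ≥0∞ :=
  ENNReal.ofReal (Real.exp (-m * |x|)) * ENNReal.ofReal |x| ^ (-γ)

/-- The `n`-fold convolution `f^{n⋆}` for `n ≥ 1`: `f^{1⋆} = f` and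
`f^{(n+1)⋆}(x) = ∫ f(x-y) f^{n⋆}(y) dy`. The value at `n = 0` is a dummy and is never used. -/
def convPow (f : ℝ → ℝ≥0∞) : ℕ → ℝ → ℝ≥0∞
  | 0 => 0
  | 1 => f
  | n + 2 => lconvolution (convPow f (n + 1)) f volume

/-- The norm `‖f‖₁` of a nonnegative function, as a real number. -/
def normOne (f : ℝ → ℝ≥0∞) : ℝ := (∫⁻ x, f x).toReal

/-- The density `p_lam(x) = e^{-lam ‖f‖₁} ∑_{n ≥ 1} lam^n f^{n⋆}(x) / n!` of the absolutely
continuous part of the compound Poisson measure with parameter `lam` built for `f`. -/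
def poissonDensity (f : ℝ → ℝ≥0∞) (lam x : ℝ) : ℝ≥0∞ :=
  ENNReal.ofReal (Real.exp (-lam * normOne f)) *
    ∑' n : ℕ, ENNReal.ofReal (lam ^ (n + 1) / ((n + 1)! : ℝ)) * convPow f (n + 1) x

/-- The Wright (generalized Bessel) function `φ(ρ, β; t) = ∑_{n ≥ 0} t^n / (Γ(ρ n + β) n!)`
for `ρ > 0`, `β ≥ 0`, `t > 0`. For `β = 0` the term `n = 0` vanishes, as `1/Γ(0) = 0`
(also with Mathlib's value `Real.Gamma 0 = 0`). -/
def wright (ρ β t : ℝ) : ℝ := ∑' n : ℕ, t ^ n / (Real.Gamma (ρ * n + β) * (n ! : ℝ))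

/-- `C` is an admissible constant for the slow decay of `f` at infinity:
`f(x) ≤ C f(y)` for `1 ≤ |x| ≤ |y| ≤ |x| + 1`. -/
def SlowDecayWith (f : ℝ → ℝ≥0∞) (C : ℝ) : Prop :=
  1 ≤ C ∧ ∀ x y : ℝ, 1 ≤ |x| → |x| ≤ |y| → |y| ≤ |x| + 1 → f x ≤ ENNReal.ofReal C * f y

/-- `C` is an admissible constant for the doubling property of `f` at zero:
`f(x) ≤ C f(2x)` for `|x| ≤ 1`. -/
def DoublingAtZeroWith (f : ℝ → ℝ≥0∞) (C : ℝ) : Prop :=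
  1 ≤ C ∧ ∀ x : ℝ, |x| ≤ 1 → f x ≤ ENNReal.ofReal C * f (2 * x)

/-- The constant `M₂ = (C₁ ∨ C₂) ‖f‖₁`. -/
def M₂ (f : ℝ → ℝ≥0∞) (C₁ C₂ : ℝ) : ℝ := max C₁ C₂ * normOne f

end ExpDensity

end

/-!
Write `a = 1 - γ`. Restricted to the half-line `(0, ∞)`, the density `f` is `exp (-m x) x ^ (a - 1)`,
a multiple of a Gamma density, so its `k`-fold convolution power over the half-line is explicit, by
Euler's Beta integral: it is `g_k(x) = Γ(a)^k / Γ(a k) * x ^ (a k - 1) * exp (-m x)`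
(`halfLineConvPow`). All estimates compare `f^{n⋆}` with these functions.

The lower bound `g_n ≤ f^{n⋆}` on `(0, ∞)` holds because the half-line convolution integrates over
less. For the upper bound the point is that `f` is a nonincreasing function of `|x|`, that this
property is stable under convolution (`IsSymmDecreasing.lconvolution`), and hence that it is shared
by all `f^{n⋆}`. Splitting `∫ f^{n⋆}(y) f(x - y) dy` at `y = 0` and `y = x`, the outer parts are
bounded by `f(x) ‖f‖₁^n` and `f^{n⋆}(x) ‖f‖₁`, and the inner part is again a half-line
convolution. Pascal's rule then gives by induction (`convPow_le_sum`), for all `x > 0`,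
`f^{n⋆}(x) ≤ ∑_k (n choose k) ‖f‖₁^(n-k) g_k(x)`.

With `Γ ≥ 1/2` on `(0, ∞)` this yields the bound for `f^{n⋆}` and the limits. Summed against
`lam ^ n / n!`, the binomial sum factors into `exp (lam ‖f‖₁)` and the exponential generating
function of the `g_k`, which is `exp (-m x) x⁻¹ φ(a, 0; Γ(a) lam x ^ a)`. This is the bound for the
compound Poisson density (`poissonDensity_bounds`). As `C₁ ≥ 1`, one has `‖f‖₁ ≤ M₂`.

It remains to determine the size of `φ(a, 0; t)`. For small `t` the first term dominates. Otherwise,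
by Stirling's formula, the `n`-th term is, up to constants depending on `a`, the exponential of
`ψ((1 + a) n)` with `ψ(u) = u + u log w - u log u` and `w = (1 + a) / a * (a t) ^ (1 / (1 + a))`.
This is maximal at `u = w`, with value `w` and a peak of width `√w`, so that `φ(a, 0; t)` is of order
`√w * exp w`: the terms at the peak give the lower bound (`le_wright`), and a comparison with the
series of `exp w`, whose terms have the same shape, gives the upper bound (`wright_le`).
-/

namespace ExpDensity

open Finset.HasAntidiagonal (antidiagonal)

/-! ### The Gamma function and Stirling's formula -/

lemma half_le_Gamma {s : ℝ} (hs : 0 < s) : 1 / 2 ≤ Real.Gamma s := by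
  -- on `[1, 2]`, log-convexity gives `1 = Γ(2)² ≤ Γ(s) Γ(4 - s)` with `Γ(4 - s) ≤ Γ(3) = 2`
  have key : ∀ s : ℝ, 1 ≤ s → s ≤ 2 → 1 / 2 ≤ Real.Gamma s := by
    intro s h1 h2
    have hc := Real.Gamma_mul_add_mul_le_rpow_Gamma_mul_rpow_Gamma (s := s) (t := 4 - s)
      (a := 1 / 2) (b := 1 / 2) (by linarith) (by linarith) (by norm_num) (by norm_num)
      (by norm_num)
    have e2 : 1 / 2 * s + 1 / 2 * (4 - s) = 2 := by ring
    have hp1 : 0 < Real.Gamma s := Real.Gamma_pos_of_pos (by linarith)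
    have hp2 : 0 < Real.Gamma (4 - s) := Real.Gamma_pos_of_pos (by linarith)
    rw [e2, Real.Gamma_two, ← Real.mul_rpow hp1.le hp2.le, ← Real.sqrt_eq_rpow,
      Real.one_le_sqrt] at hc
    have h3 : Real.Gamma (4 - s) ≤ Real.Gamma 3 :=
      Real.Gamma_strictMonoOn_Ici.monotoneOn (show (2 : ℝ) ≤ 4 - s by linarith)
        (show (2 : ℝ) ≤ 3 by norm_num) (by linarith)
    have h4 : Real.Gamma 3 = 2 := by
      rw [show (3 : ℝ) = (2 : ℕ) + 1 by norm_num, Real.Gamma_nat_eq_factorial]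
      norm_num
    nlinarith
  rcases le_total s 1 with h | h
  · have h5 := key (s + 1) (by linarith) (by linarith)
    rw [Real.Gamma_add_one hs.ne'] at h5
    have hp1 : 0 < Real.Gamma s := Real.Gamma_pos_of_pos hs
    nlinarith
  · rcases le_total s 2 with h' | h'
    · exact key s h h'
    · have := Real.Gamma_strictMonoOn_Ici.monotoneOn (show (2 : ℝ) ≤ 2 from le_rfl)
        (show (2 : ℝ) ≤ s from h') h'
      rw [Real.Gamma_two] at this
      linarith

/-- A tangent-line bound for the logarithm. -/
lemma log_le_log_add_div {a b : ℝ} (ha : 0 < a) (hb : 0 < b) :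
    Real.log b ≤ Real.log a + (b - a) / a := by
  have h := Real.log_le_sub_one_of_pos (div_pos hb ha)
  rw [Real.log_div hb.ne' ha.ne'] at h
  have : b / a - 1 = (b - a) / a := by field_simp
  linarith

lemma abs_log_factorial_sub_le (n : ℕ) :
    |Real.log (n ! : ℝ) - ((n : ℝ) * Real.log n - n + 1 / 2 * Real.log (n + 1))| ≤ 1 := by
  rcases Nat.eq_zero_or_pos n with rfl | hn
  · simp
  have hn' : (1 : ℝ) ≤ n := by exact_mod_cast hn
  have hform := Stirling.log_stirlingSeq_formula n
  have hlow := Stirling.sqrt_pi_le_stirlingSeq hn.ne'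
  have hup : Stirling.stirlingSeq n ≤ Real.exp 1 / √2 := by
    have h := Stirling.stirlingSeq'_antitone (Nat.zero_le (n - 1))
    simp only [Function.comp, Nat.succ_eq_add_one, zero_add] at h
    rwa [Nat.sub_add_cancel hn, Stirling.stirlingSeq_one] at h
  have hpos : 0 < Stirling.stirlingSeq n := lt_of_lt_of_le (by positivity) hlow
  have h1 := Real.log_le_log (by positivity) hlow
  have h2 := Real.log_le_log hpos hup
  rw [Real.log_sqrt Real.pi_pos.le] at h1
  rw [Real.log_div (Real.exp_pos 1).ne' (by positivity), Real.log_exp,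
    Real.log_sqrt (by norm_num)] at h2
  rw [Real.log_mul (by norm_num) (by positivity), Real.log_div (by positivity)
    (Real.exp_pos 1).ne', Real.log_exp] at hform
  have hpi : Real.log 2 ≤ Real.log Real.pi :=
    Real.log_le_log (by norm_num) Real.two_le_pi
  have h3 : Real.log n ≤ Real.log ((n : ℝ) + 1) := Real.log_le_log (by linarith) (by linarith)
  have h4 : Real.log ((n : ℝ) + 1) ≤ Real.log 2 + Real.log n := by
    rw [← Real.log_mul (by norm_num) (by positivity)]
    exact Real.log_le_log (by linarith) (by linarith)
  have h5 : 0 < Real.log 2 := Real.log_pos (by norm_num)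
  rw [abs_le]
  constructor <;> nlinarith

/-- A crude form of Stirling's formula for `Γ(u + 1)`, uniform in `u ≥ 0`. It is interpolated
from the integers by log-convexity of the Gamma function. -/
lemma abs_log_Gamma_add_one_sub_le {u : ℝ} (hu : 0 ≤ u) :
    |Real.log (Real.Gamma (u + 1)) - (u * Real.log u - u + 1 / 2 * Real.log (u + 1))| ≤ 4 := by
  obtain ⟨n, s, hs0, hs1, rfl⟩ : ∃ (n : ℕ) (s : ℝ), 0 ≤ s ∧ s < 1 ∧ u = n + s :=
    ⟨⌊u⌋₊, u - ⌊u⌋₊, sub_nonneg.2 (Nat.floor_le hu), by linarith [Nat.lt_floor_add_one u],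
      by ring⟩
  rcases hs0.eq_or_lt with rfl | hs
  · have h := abs_log_factorial_sub_le n
    rw [add_zero, Real.Gamma_nat_eq_factorial]
    exact h.trans (by norm_num)
  have hn : (0 : ℝ) ≤ n := n.cast_nonneg
  have hfeq : ∀ y : ℝ, 0 < y →
      Real.log (Real.Gamma (y + 1)) = Real.log (Real.Gamma y) + Real.log y := by
    intro y hy
    rw [Real.Gamma_add_one hy.ne', Real.log_mul hy.ne' (Real.Gamma_pos_of_pos hy).ne']
    ring
  have hc := Real.convexOn_log_Gamma.2
  simp only [Function.comp, smul_eq_mul] at hc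
  have hup := hc (show (0 : ℝ) < n + 1 by linarith) (show (0 : ℝ) < n + 1 + 1 by linarith)
    (show 0 ≤ 1 - s by linarith) hs.le (by ring)
  rw [show (1 - s) * ((n : ℝ) + 1) + s * (n + 1 + 1) = n + s + 1 by ring,
    hfeq (n + 1) (by linarith)] at hup
  have hlow := hc (show (0 : ℝ) < n + s + 1 by linarith) (show (0 : ℝ) < n + s + 1 + 1 by linarith)
    hs.le (show 0 ≤ 1 - s by linarith) (by ring)
  rw [show s * ((n : ℝ) + s + 1) + (1 - s) * (n + s + 1 + 1) = n + 1 + 1 by ring,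
    hfeq (n + s + 1) (by linarith), hfeq (n + 1) (by linarith)] at hlow
  have hfac := abs_le.1 (abs_log_factorial_sub_le n)
  rw [← Real.Gamma_nat_eq_factorial] at hfac
  have t1 : (1 - s) * Real.log ((n : ℝ) + s + 1) ≤ (1 - s) * Real.log (n + 1) + 1 := by
    have h := log_le_log_add_div (show (0 : ℝ) < n + 1 by linarith)
      (show (0 : ℝ) < n + s + 1 by linarith)
    have h' : ((n : ℝ) + s + 1 - (n + 1)) / (n + 1) ≤ 1 := by
      rw [div_le_one (by linarith)]; linarith
    nlinarith
  have t2 : s * Real.log ((n : ℝ) + 1) ≤ s * Real.log (n + s) + 1 := by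
    have h := log_le_log_add_div (show (0 : ℝ) < n + s by linarith)
      (show (0 : ℝ) < n + 1 by linarith)
    have h' : s * (((n : ℝ) + 1 - (n + s)) / (n + s)) ≤ 1 := by
      rw [mul_div_assoc', div_le_one (by linarith)]; nlinarith
    nlinarith
  have t3 : (n : ℝ) * Real.log n ≤ n * Real.log (n + s) := by
    rcases hn.eq_or_lt with h0 | h0
    · rw [← h0]; simp
    · exact mul_le_mul_of_nonneg_left (Real.log_le_log h0 (by linarith)) hn
  have t4 : ((n : ℝ) + s) * Real.log (n + s) ≤ (n + s) * Real.log (n + 1) :=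
    mul_le_mul_of_nonneg_left (Real.log_le_log (by linarith) (by linarith)) (by linarith)
  have t5 : (n : ℝ) * Real.log (n + 1) ≤ n * Real.log n + 1 := by
    rcases hn.eq_or_lt with h0 | h0
    · rw [← h0]; simp
    · have h := log_le_log_add_div h0 (show (0 : ℝ) < n + 1 by linarith)
      have h2 : (n : ℝ) * (((n : ℝ) + 1 - n) / n) = 1 := by field_simp; ring
      nlinarith
  have t6 : Real.log ((n : ℝ) + 1) ≤ Real.log (n + s + 1) :=
    Real.log_le_log (by linarith) (by linarith)
  have t7 : Real.log ((n : ℝ) + s + 1) ≤ Real.log (n + 1) + 1 := by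
    have h := log_le_log_add_div (show (0 : ℝ) < n + 1 by linarith)
      (show (0 : ℝ) < n + s + 1 by linarith)
    have h' : ((n : ℝ) + s + 1 - (n + 1)) / (n + 1) ≤ 1 := by
      rw [div_le_one (by linarith)]; linarith
    linarith
  rw [abs_le]
  constructor <;> linarith [hfac.1, hfac.2]

/-! ### Growth of the Wright function -/

/-- The exponent `ψ_w(u) = u + u log w - u log u`. By Stirling's formula `exp (ψ_w(u))` is
`w ^ u / Γ(u + 1)` up to a factor of order `√(u + 1)`; it is maximal at `u = w`, with `ψ_w(w) = w`. -/
noncomputable def stirlingExponent (w u : ℝ) : ℝ := u + u * Real.log w - u * Real.log u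

/-- `ψ_w` is concave; on an interval of length one it exceeds the larger of the endpoint values
by at most one. -/
lemma stirlingExponent_add_le {w k s : ℝ} (hk : 0 < k) (hs0 : 0 ≤ s) (hs1 : s ≤ 1) :
    stirlingExponent w (k + s) ≤
      max (stirlingExponent w k) (stirlingExponent w (k + 1)) + 1 := by
  have hks : 0 < k + s := by linarith
  have h1 := log_le_log_add_div hks (show 0 < k + 1 by linarith)
  have h2 := log_le_log_add_div hks hk
  have h3 : stirlingExponent w (k + s) ≤
      (1 - s) * stirlingExponent w k + s * stirlingExponent w (k + 1) + 1 := by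
    have h1' := mul_le_mul_of_nonneg_left h1 (show 0 ≤ s * (k + 1) by positivity)
    have h2' := mul_le_mul_of_nonneg_left h2
      (show 0 ≤ (1 - s) * k from mul_nonneg (by linarith) hk.le)
    have h4 : s * (k + 1) * ((k + 1 - (k + s)) / (k + s)) + (1 - s) * k * ((k - (k + s)) / (k + s))
        = s * (1 - s) / (k + s) := by field_simp; ring
    have h5 : s * (1 - s) / (k + s) ≤ 1 := by
      rw [div_le_one hks]; nlinarith
    unfold stirlingExponent
    nlinarith
  have h6 := mul_le_mul_of_nonneg_left
    (le_max_left (stirlingExponent w k) (stirlingExponent w (k + 1))) (show 0 ≤ 1 - s by linarith)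
  have h7 := mul_le_mul_of_nonneg_left
    (le_max_right (stirlingExponent w k) (stirlingExponent w (k + 1))) hs0
  linarith

lemma le_stirlingExponent {w d : ℝ} (hw : 0 < w) (hd : 0 ≤ d) :
    w - d ^ 2 / w ≤ stirlingExponent w (w + d) := by
  have h := log_le_log_add_div hw (show 0 < w + d by linarith)
  have h' := mul_le_mul_of_nonneg_left h (show 0 ≤ w + d by linarith)
  have e : (w + d) * ((w + d - w) / w) = d + d ^ 2 / w := by field_simp; ring
  unfold stirlingExponent
  nlinarith

lemma exp_stirlingExponent_natCast_le {w : ℝ} (hw : 0 < w) (k : ℕ) :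
    Real.exp (stirlingExponent w k) ≤ Real.exp 1 * (√(k + 1) * (w ^ k / k !)) := by
  have h := (abs_le.1 (abs_log_factorial_sub_le k)).2
  have hk : (0 : ℝ) < k + 1 := by positivity
  have hf : (0 : ℝ) < k ! := by positivity
  rw [← Real.le_log_iff_exp_le (by positivity), Real.log_mul (by positivity) (by positivity),
    Real.log_exp, Real.log_mul (by positivity) (by positivity), Real.log_sqrt hk.le,
    Real.log_div (by positivity) hf.ne', Real.log_pow]
  unfold stirlingExponent
  linarith

lemma hasSum_add_one_mul_pow_div_factorial (w : ℝ) :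
    HasSum (fun k : ℕ => ((k : ℝ) + 1) * (w ^ k / k !)) ((w + 1) * Real.exp w) := by
  have h0 : HasSum (fun k : ℕ => w ^ k / (k ! : ℝ)) (Real.exp w) := by
    rw [Real.exp_eq_exp_ℝ]
    exact NormedSpace.expSeries_div_hasSum_exp w
  have h1 : HasSum (fun k : ℕ => (k : ℝ) * (w ^ k / (k ! : ℝ))) (w * Real.exp w) := by
    rw [← hasSum_nat_add_iff' 1]
    have h2 := h0.mul_left w
    have e : (fun k : ℕ => w * (w ^ k / (k ! : ℝ))) =
        fun k : ℕ => ((k + 1 : ℕ) : ℝ) * (w ^ (k + 1) / ((k + 1)! : ℝ)) := by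
      ext k
      have h4 : (k : ℝ) + 1 ≠ 0 := by positivity
      have h5 : (k ! : ℝ) ≠ 0 := by positivity
      rw [Nat.factorial_succ]
      push_cast
      field_simp
      ring
    rw [e] at h2
    simpa using h2
  have h3 := h1.add h0
  have e : w * Real.exp w + Real.exp w = (w + 1) * Real.exp w := by ring
  rw [e] at h3
  convert h3 using 2
  ring

/-- The exponent `w = (1 + a) / a * (a * t) ^ (1 / (1 + a))` in the growth of the Wright function:
`φ(a, 0; t)` is of order `√w * exp w`. -/
noncomputable def wrightExponent (a t : ℝ) : ℝ := (1 + a) / a * (a * t) ^ (1 / (1 + a))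

lemma mul_log_wrightExponent {a t : ℝ} (ha : 0 < a) (ht : 0 < t) :
    (1 + a) * Real.log (wrightExponent a t) =
      (1 + a) * Real.log (1 + a) - a * Real.log a + Real.log t := by
  have h1 : (1 + a : ℝ) ≠ 0 := by positivity
  unfold wrightExponent
  rw [Real.log_mul (by positivity) (by positivity), Real.log_div h1 ha.ne',
    Real.log_rpow (by positivity), Real.log_mul ha.ne' ht.ne']
  field_simp
  ring

/-- Stirling's formula for the terms of the Wright series. -/
lemma abs_log_wright_term_sub_le {a t : ℝ} (ha : 0 < a) (ha1 : a ≤ 1) (ht : 0 < t) {n : ℕ}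
    (hn : 1 ≤ n) :
    |Real.log (t ^ n / (Real.Gamma (a * n + 0) * (n ! : ℝ))) -
      stirlingExponent (wrightExponent a t) ((1 + a) * n)| ≤ 9 + 2 * |Real.log a| := by
  have hn' : (1 : ℝ) ≤ n := by exact_mod_cast hn
  have hn0 : (0 : ℝ) < n := by linarith
  have han : 0 < a * n := by positivity
  have hG : 0 < Real.Gamma (a * n) := Real.Gamma_pos_of_pos han
  have hf : (0 : ℝ) < n ! := by positivity
  have h1 := abs_le.1 (abs_log_factorial_sub_le n)
  have h2 := abs_le.1 (abs_log_Gamma_add_one_sub_le han.le)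
  rw [Real.Gamma_add_one han.ne', Real.log_mul han.ne' hG.ne', Real.log_mul ha.ne' hn0.ne'] at h2
  have h3 : Real.log ((n : ℝ) + 1) ≤ Real.log 2 + Real.log n := by
    rw [← Real.log_mul (by norm_num) (by positivity)]
    exact Real.log_le_log (by linarith) (by linarith)
  have h4 : Real.log (n : ℝ) ≤ Real.log (n + 1) := Real.log_le_log hn0 (by linarith)
  have h5 : Real.log (a * n + 1) ≤ Real.log (n + 1) :=
    Real.log_le_log (by linarith) (by nlinarith)
  have h6 : Real.log a + Real.log (n : ℝ) ≤ Real.log (a * n + 1) := by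
    rw [← Real.log_mul ha.ne' hn0.ne']
    exact Real.log_le_log (by linarith) (by nlinarith)
  have h7 : Real.log 2 ≤ 1 := by linarith [Real.log_two_lt_d9]
  have h8 : Real.log a ≤ 0 := Real.log_nonpos ha.le ha1
  have hw := mul_log_wrightExponent ha ht
  have hw' : (1 + a) * n * Real.log (wrightExponent a t) =
      n * ((1 + a) * Real.log (1 + a) - a * Real.log a + Real.log t) := by
    rw [← hw]; ring
  rw [add_zero, Real.log_div (by positivity) (by positivity), Real.log_mul hG.ne' hf.ne',
    Real.log_pow, stirlingExponent, hw', Real.log_mul (by positivity) hn0.ne', abs_of_nonpos h8]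
  rw [abs_le]
  constructor <;> nlinarith [h1.1, h1.2, h2.1, h2.2]

lemma wright_term_nonneg {a t : ℝ} (ha : 0 < a) (ht : 0 < t) (n : ℕ) :
    0 ≤ t ^ n / (Real.Gamma (a * n + 0) * (n ! : ℝ)) := by
  have : 0 ≤ Real.Gamma (a * n + 0) := Real.Gamma_nonneg_of_nonneg (by positivity)
  positivity

lemma wright_term_le {a t : ℝ} (ha : 0 < a) (ht : 0 < t) (n : ℕ) :
    t ^ n / (Real.Gamma (a * n + 0) * (n ! : ℝ)) ≤ 2 * (t ^ n / n !) := by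
  rcases Nat.eq_zero_or_pos n with rfl | hn
  · simp
  have hG := half_le_Gamma (s := a * n + 0) (by positivity)
  have hf : (0 : ℝ) < n ! := by positivity
  rw [mul_comm (Real.Gamma _), ← div_div, div_le_iff₀ (by linarith)]
  have : 0 ≤ t ^ n / (n ! : ℝ) := by positivity
  nlinarith

lemma summable_wright {a t : ℝ} (ha : 0 < a) (ht : 0 < t) :
    Summable fun n : ℕ => t ^ n / (Real.Gamma (a * n + 0) * (n ! : ℝ)) :=
  Summable.of_nonneg_of_le (wright_term_nonneg ha ht) (wright_term_le ha ht)
    ((Real.summable_pow_div_factorial t).mul_left 2)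

/-- The terms of the Wright series with index near `w / (1 + a)`, about `√w` of them, are all of
order `exp w`. -/
lemma le_wright {a t : ℝ} (ha : 0 < a) (ha1 : a ≤ 1) (ht : 0 < t)
    (hw : 1 ≤ wrightExponent a t) :
    Real.exp (-(9 + 2 * |Real.log a|) - 16) *
      (√(wrightExponent a t) * Real.exp (wrightExponent a t)) ≤ wright a 0 t := by
  set w := wrightExponent a t with hwdef
  set K := 9 + 2 * |Real.log a|
  have hw0 : 0 < w := by linarith
  have hr : 0 < 1 + a := by linarith
  set M := ⌈w / (1 + a)⌉₊
  set N := ⌊√w⌋₊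
  have hM : 1 ≤ M := Nat.one_le_ceil_iff.2 (by positivity)
  have hs1 : 1 ≤ √w := Real.one_le_sqrt.2 hw
  have hterm : ∀ n ∈ Finset.Icc M (M + N), Real.exp (-K - 16 + w) ≤
      t ^ n / (Real.Gamma (a * n + 0) * (n ! : ℝ)) := by
    intro n hn
    rw [Finset.mem_Icc] at hn
    have hn1 : 1 ≤ n := hM.trans hn.1
    have hpos : 0 < t ^ n / (Real.Gamma (a * n + 0) * (n ! : ℝ)) := by
      have : 0 < Real.Gamma (a * n + 0) := Real.Gamma_pos_of_pos (by positivity)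
      positivity
    rw [← Real.le_log_iff_exp_le hpos]
    have h1 := (abs_le.1 (abs_log_wright_term_sub_le ha ha1 ht hn1)).1
    have hd0 : w ≤ (1 + a) * n := by
      have h : w / (1 + a) ≤ n := (Nat.le_ceil _).trans (by exact_mod_cast hn.1)
      rw [div_le_iff₀ hr] at h
      linarith
    have hd1 : (1 + a) * n - w ≤ 4 * √w := by
      have h2 : (n : ℝ) ≤ M + N := by exact_mod_cast hn.2
      have h3 : (M : ℝ) < w / (1 + a) + 1 := Nat.ceil_lt_add_one (by positivity)
      have h4 : (N : ℝ) ≤ √w := Nat.floor_le (by positivity)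
      have h5 : (n : ℝ) - w / (1 + a) ≤ 2 * √w := by linarith
      have h6 : (1 + a) * (n - w / (1 + a)) = (1 + a) * n - w := by field_simp
      rw [← h6]
      nlinarith
    have h2 := le_stirlingExponent hw0 (sub_nonneg.2 hd0)
    rw [add_sub_cancel] at h2
    have h3 : ((1 + a) * n - w) ^ 2 / w ≤ 16 := by
      rw [div_le_iff₀ hw0]
      calc ((1 + a) * n - w) ^ 2 ≤ (4 * √w) ^ 2 :=
            pow_le_pow_left₀ (sub_nonneg.2 hd0) hd1 2
        _ = 16 * w := by rw [mul_pow, Real.sq_sqrt hw0.le]; norm_num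
    linarith
  have hsum := Finset.card_nsmul_le_sum _ _ _ hterm
  have hcard : √w ≤ ((Finset.Icc M (M + N)).card : ℝ) := by
    rw [Nat.card_Icc]
    have h := (Nat.lt_floor_add_one (√w)).le
    rw [show M + N + 1 - M = N + 1 by omega]
    exact_mod_cast h
  have hle := (summable_wright ha ht).sum_le_tsum (Finset.Icc M (M + N))
    fun n _ => wright_term_nonneg ha ht n
  rw [nsmul_eq_mul] at hsum
  calc Real.exp (-K - 16) * (√w * Real.exp w) = √w * Real.exp (-K - 16 + w) := by
        rw [Real.exp_add]; ring
    _ ≤ _ := mul_le_mul_of_nonneg_right hcard (Real.exp_pos _).le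
    _ ≤ _ := hsum
    _ ≤ _ := hle

/-- The terms of the Wright series are compared with the numbers `√(k + 1) * w ^ k / k!` for the
two integers `k` around `(1 + a) * n`; these sum up to a multiple of `√w * exp w`. -/
lemma wright_le {a t : ℝ} (ha : 0 < a) (ha1 : a ≤ 1) (ht : 0 < t)
    (hw : 1 ≤ wrightExponent a t) :
    wright a 0 t ≤ 4 * Real.exp (9 + 2 * |Real.log a| + 2) *
      (√(wrightExponent a t) * Real.exp (wrightExponent a t)) := by
  set w := wrightExponent a t with hwdef
  set K := 9 + 2 * |Real.log a|
  have hw0 : 0 < w := by linarith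
  have hsw : 0 < √w := Real.sqrt_pos.2 hw0
  have hsq : √w * √w = w := Real.mul_self_sqrt hw0.le
  set c : ℕ → ℝ := fun k => √(k + 1) * (w ^ k / k !) with hc
  have hc0 : ∀ k, 0 ≤ c k := fun k => by positivity
  have hexp : HasSum (fun k : ℕ => w ^ k / (k ! : ℝ)) (Real.exp w) := by
    rw [Real.exp_eq_exp_ℝ]
    exact NormedSpace.expSeries_div_hasSum_exp w
  have hdom := ((hasSum_add_one_mul_pow_div_factorial w).mul_left (1 / (2 * √w))).add
    (hexp.mul_left (√w / 2))
  -- the inequality between the means: `√(k + 1) ≤ ((k + 1) / √w + √w) / 2`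
  have hcle : ∀ k : ℕ, c k ≤ 1 / (2 * √w) * (((k : ℝ) + 1) * (w ^ k / k !)) +
      √w / 2 * (w ^ k / k !) := by
    intro k
    have hk : (0 : ℝ) ≤ (k : ℝ) + 1 := by positivity
    have h1 : √((k : ℝ) + 1) ≤ 1 / (2 * √w) * ((k : ℝ) + 1) + √w / 2 := by
      have h2 := Real.mul_self_sqrt hk
      have h3 := sq_nonneg (√((k : ℝ) + 1) - √w)
      rw [show 1 / (2 * √w) * ((k : ℝ) + 1) + √w / 2 = (((k : ℝ) + 1) + √w * √w) / (2 * √w) by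
        field_simp, le_div_iff₀ (by positivity)]
      nlinarith
    have h4 : 0 ≤ w ^ k / (k ! : ℝ) := by positivity
    calc c k ≤ (1 / (2 * √w) * ((k : ℝ) + 1) + √w / 2) * (w ^ k / k !) :=
          mul_le_mul_of_nonneg_right h1 h4
      _ = _ := by ring
  have hcs : Summable c := Summable.of_nonneg_of_le hc0 hcle hdom.summable
  have hctsum : ∑' k, c k ≤ 2 * (√w * Real.exp w) := by
    refine (hcs.tsum_le_tsum hcle hdom.summable).trans ?_
    rw [hdom.tsum_eq]
    have h1 : 1 / (2 * √w) * ((w + 1) * Real.exp w) ≤ √w * Real.exp w := by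
      rw [← mul_assoc]
      refine mul_le_mul_of_nonneg_right ?_ (Real.exp_pos w).le
      rw [one_div_mul_eq_div, div_le_iff₀ (by positivity)]
      nlinarith
    nlinarith [mul_pos hsw (Real.exp_pos w)]
  set i : ℕ → ℕ := fun n => ⌊(1 + a) * n⌋₊ with hi
  have hiinj : Function.Injective i := by
    refine StrictMono.injective (strictMono_nat_of_lt_succ fun n => ?_)
    have h1 : ((i n : ℕ) : ℝ) ≤ (1 + a) * n := Nat.floor_le (by positivity)
    refine Nat.lt_of_succ_le (Nat.le_floor ?_)
    push_cast
    linarith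
  have hisucc : Function.Injective fun n => i n + 1 := (add_left_injective 1).comp hiinj
  have hterm : ∀ n : ℕ, t ^ n / (Real.Gamma (a * n + 0) * (n ! : ℝ)) ≤
      Real.exp (K + 2) * (c (i n) + c (i n + 1)) := by
    intro n
    rcases Nat.eq_zero_or_pos n with rfl | hn
    · have := hc0 (i 0)
      have := hc0 (i 0 + 1)
      have h : (0 : ℝ) ≤ Real.exp (K + 2) * (c (i 0) + c (i 0 + 1)) := by positivity
      simpa using h
    have hn' : (1 : ℝ) ≤ n := by exact_mod_cast hn
    have hpos : 0 < t ^ n / (Real.Gamma (a * n + 0) * (n ! : ℝ)) := by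
      have : 0 < Real.Gamma (a * n + 0) := Real.Gamma_pos_of_pos (by positivity)
      positivity
    have hi1 : (0 : ℝ) < i n := by
      have : 1 ≤ i n := Nat.le_floor (by push_cast; nlinarith)
      exact_mod_cast this
    have hfl : ((i n : ℕ) : ℝ) ≤ (1 + a) * n := Nat.floor_le (by positivity)
    have hfl' : (1 + a) * n < (i n : ℝ) + 1 := Nat.lt_floor_add_one _
    have h1 := (abs_le.1 (abs_log_wright_term_sub_le ha ha1 ht hn)).2
    have h2 := stirlingExponent_add_le (w := w) hi1 (sub_nonneg.2 hfl) (by linarith)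
    rw [add_sub_cancel] at h2
    have h3 := exp_stirlingExponent_natCast_le hw0 (i n)
    have h4 := exp_stirlingExponent_natCast_le hw0 (i n + 1)
    rw [Nat.cast_add_one] at h4
    have h5 : Real.exp (max (stirlingExponent w (i n)) (stirlingExponent w (i n + 1))) ≤
        Real.exp 1 * (c (i n) + c (i n + 1)) := by
      have h6 : c (i n + 1) = √((i n : ℝ) + 1 + 1) * (w ^ (i n + 1) / (i n + 1)!) := by
        simp [hc]
      rw [mul_add, h6]
      have h7 : 0 ≤ Real.exp 1 * c (i n) := mul_nonneg (Real.exp_pos _).le (hc0 _)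
      have h8 : 0 ≤ Real.exp 1 * c (i n + 1) := mul_nonneg (Real.exp_pos _).le (hc0 _)
      rw [h6] at h8
      rcases max_choice (stirlingExponent w (i n)) (stirlingExponent w (i n + 1)) with h | h <;>
        rw [h]
      · exact h3.trans (le_add_of_nonneg_right h8)
      · exact h4.trans (le_add_of_nonneg_left h7)
    calc t ^ n / (Real.Gamma (a * n + 0) * (n ! : ℝ))
        ≤ Real.exp (K + 1 + max (stirlingExponent w (i n)) (stirlingExponent w (i n + 1))) := by
          rw [← Real.log_le_iff_le_exp hpos]; linarith
      _ ≤ Real.exp (K + 1) * (Real.exp 1 * (c (i n) + c (i n + 1))) := by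
          rw [Real.exp_add]
          exact mul_le_mul_of_nonneg_left h5 (Real.exp_pos _).le
      _ = Real.exp (K + 2) * (c (i n) + c (i n + 1)) := by
          rw [← mul_assoc, ← Real.exp_add]; ring_nf
  have hs1 : Summable fun n => c (i n) := hcs.comp_injective hiinj
  have hs2 : Summable fun n => c (i n + 1) := hcs.comp_injective hisucc
  have hle1 : ∑' n, c (i n) ≤ ∑' k, c k := tsum_comp_le_tsum_of_inj hcs hc0 hiinj
  have hle2 : ∑' n, c (i n + 1) ≤ ∑' k, c k := tsum_comp_le_tsum_of_inj hcs hc0 hisucc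
  calc wright a 0 t ≤ ∑' n, Real.exp (K + 2) * (c (i n) + c (i n + 1)) :=
        (summable_wright ha ht).tsum_le_tsum hterm ((hs1.add hs2).mul_left _)
    _ = Real.exp (K + 2) * (∑' n, c (i n) + ∑' n, c (i n + 1)) := by
        rw [tsum_mul_left, hs1.tsum_add hs2]
    _ ≤ Real.exp (K + 2) * (2 * (√w * Real.exp w) + 2 * (√w * Real.exp w)) :=
        mul_le_mul_of_nonneg_left (by linarith) (Real.exp_pos _).le
    _ = _ := by ring

/-- For small `s`, the Wright function is dominated by its first term. -/
lemma wright_Gamma_mul_bounds {a s : ℝ} (ha : 0 < a) (hs : 0 < s) :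
    s ≤ wright a 0 (Real.Gamma a * s) ∧
      (s ≤ 1 → wright a 0 (Real.Gamma a * s) ≤ 2 * Real.exp (Real.Gamma a) * s) := by
  have hG : 0 < Real.Gamma a := Real.Gamma_pos_of_pos ha
  have ht : 0 < Real.Gamma a * s := by positivity
  constructor
  · have h := (summable_wright ha ht).sum_le_tsum {1} fun n _ => wright_term_nonneg ha ht n
    rw [Finset.sum_singleton] at h
    refine le_trans (le_of_eq ?_) h
    simp only [Nat.cast_one, mul_one, add_zero, pow_one, Nat.factorial_one]
    field_simp
  · intro hs1
    have hterm : ∀ n : ℕ, (Real.Gamma a * s) ^ n / (Real.Gamma (a * n + 0) * (n ! : ℝ)) ≤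
        2 * s * (Real.Gamma a ^ n / n !) := by
      intro n
      rcases Nat.eq_zero_or_pos n with rfl | hn
      · simp [hs.le]
      refine (wright_term_le ha ht n).trans ?_
      have h1 : s ^ n ≤ s := pow_le_of_le_one hs.le hs1 hn.ne'
      have h2 : 0 ≤ Real.Gamma a ^ n / (n ! : ℝ) := by positivity
      calc 2 * ((Real.Gamma a * s) ^ n / (n ! : ℝ)) = 2 * s ^ n * (Real.Gamma a ^ n / n !) := by
            rw [mul_pow]; ring
        _ ≤ _ := by gcongr
    have hexp : HasSum (fun k : ℕ => Real.Gamma a ^ k / (k ! : ℝ)) (Real.exp (Real.Gamma a)) := by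
      rw [Real.exp_eq_exp_ℝ]
      exact NormedSpace.expSeries_div_hasSum_exp _
    refine ((summable_wright ha ht).tsum_le_tsum hterm (hexp.summable.mul_left _)).trans ?_
    rw [tsum_mul_left, hexp.tsum_eq]
    exact le_of_eq (by ring)

/-! ### Symmetric decreasing functions and their convolutions -/

/-- A function on the line is symmetric decreasing if it is a nonincreasing function of `|x|`.
In particular it is even. -/
def IsSymmDecreasing (f : ℝ → ℝ≥0∞) : Prop := ∀ x y : ℝ, |x| ≤ |y| → f y ≤ f x

lemma IsSymmDecreasing.eq_of_abs_eq {f : ℝ → ℝ≥0∞} (hf : IsSymmDecreasing f) {x y : ℝ}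
    (h : |x| = |y|) : f x = f y :=
  le_antisymm (hf _ _ h.ge) (hf _ _ h.le)

/-- The rearrangement inequality for two pairs. -/
lemma mul_add_mul_le_of_le_of_le {a b c d : ℝ≥0∞} (hab : a ≤ b) (hcd : c ≤ d) :
    a * d + b * c ≤ a * c + b * d := by
  obtain ⟨e, rfl⟩ := exists_add_of_le hab
  obtain ⟨e', rfl⟩ := exists_add_of_le hcd
  have : a * c + (a + e) * (c + e') = (a * (c + e') + (a + e) * c) + e * e' := by ring
  rw [this]
  exact le_self_add

/-- The convolution of two symmetric decreasing functions is symmetric decreasing. The integrals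
that represent its values at `x` and `y` are compared after averaging the integrands over the
reflection `u ↦ x + y - u`; then the rearrangement inequality holds pointwise. -/
lemma IsSymmDecreasing.lconvolution {F f : ℝ → ℝ≥0∞} (hF : IsSymmDecreasing F)
    (hf : IsSymmDecreasing f) (hFm : Measurable F) (hfm : Measurable f) :
    IsSymmDecreasing (lconvolution F f volume) := by
  intro x y hxy
  simp only [lconvolution_def]
  have hdouble : ∀ G : ℝ → ℝ≥0∞, Measurable G →
      2 * ∫⁻ u, G u = ∫⁻ u, (G u + G (x + y - u)) := by
    intro G hG
    rw [lintegral_add_left hG, lintegral_sub_left_eq_self G, two_mul]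
  rw [← ENNReal.mul_le_mul_iff_right two_ne_zero ENNReal.ofNat_ne_top,
    hdouble (fun u => F u * f (-u + y)) (by fun_prop),
    hdouble (fun u => F u * f (-u + x)) (by fun_prop)]
  refine lintegral_mono fun u => ?_
  have e1 : f (-(x + y - u) + y) = f (-u + x) :=
    hf.eq_of_abs_eq (by rw [← abs_neg]; congr 1; ring)
  have e2 : f (-(x + y - u) + x) = f (-u + y) :=
    hf.eq_of_abs_eq (by rw [← abs_neg]; congr 1; ring)
  simp only [e1, e2]
  have hsq : x ^ 2 ≤ y ^ 2 := sq_le_sq.2 hxy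
  -- `u` and its reflection lie on different sides of the midpoint of `x` and `y`
  have hcases : (|u| ≤ |x + y - u| ∧ |-u + x| ≤ |-u + y|) ∨
      (|x + y - u| ≤ |u| ∧ |-u + y| ≤ |-u + x|) := by
    simp only [← sq_le_sq]
    rcases lt_trichotomy x y with h | rfl | h
    · have hc : 0 ≤ x + y := by nlinarith
      rcases le_total (2 * u) (x + y) with hu | hu
      · left; constructor <;> nlinarith
      · right; constructor <;> nlinarith
    · rcases le_total (u ^ 2) ((x + x - u) ^ 2) with hu | hu
      · exact Or.inl ⟨hu, le_rfl⟩
      · exact Or.inr ⟨hu, le_rfl⟩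
    · have hc : x + y ≤ 0 := by nlinarith
      rcases le_total (2 * u) (x + y) with hu | hu
      · right; constructor <;> nlinarith
      · left; constructor <;> nlinarith
  rcases hcases with ⟨h1, h2⟩ | ⟨h1, h2⟩
  · have h := mul_add_mul_le_of_le_of_le (hF _ _ h1) (hf _ _ h2)
    rw [add_comm, add_comm (F u * f (-u + x))]
    exact h
  · exact mul_add_mul_le_of_le_of_le (hF _ _ h1) (hf _ _ h2)

lemma lintegral_lconvolution {F f : ℝ → ℝ≥0∞} (hF : Measurable F) (hf : Measurable f) :
    ∫⁻ x, lconvolution F f volume x = (∫⁻ x, F x) * ∫⁻ x, f x := by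
  simp only [lconvolution_def]
  rw [lintegral_lintegral_swap (by fun_prop), ← lintegral_mul_const _ hF]
  refine lintegral_congr fun y => ?_
  rw [lintegral_const_mul _ (by fun_prop), lintegral_add_left_eq_self]

lemma convPow_succ (f : ℝ → ℝ≥0∞) {n : ℕ} (hn : 1 ≤ n) :
    convPow f (n + 1) = lconvolution (convPow f n) f volume := by
  obtain ⟨k, rfl⟩ := Nat.exists_eq_add_of_le' hn
  rfl

lemma measurable_convPow {f : ℝ → ℝ≥0∞} (hf : Measurable f) {n : ℕ} (hn : 1 ≤ n) :
    Measurable (convPow f n) := by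
  induction n, hn using Nat.le_induction with
  | base => exact hf
  | succ n hn ih =>
    rw [convPow_succ f hn]
    exact measurable_lconvolution _ ih hf

lemma isSymmDecreasing_convPow {f : ℝ → ℝ≥0∞} (hf : Measurable f) (hs : IsSymmDecreasing f)
    {n : ℕ} (hn : 1 ≤ n) : IsSymmDecreasing (convPow f n) := by
  induction n, hn using Nat.le_induction with
  | base => exact hs
  | succ n hn ih =>
    rw [convPow_succ f hn]
    exact ih.lconvolution hs (measurable_convPow hf hn) hf

lemma lintegral_convPow {f : ℝ → ℝ≥0∞} (hf : Measurable f) {n : ℕ} (hn : 1 ≤ n) :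
    ∫⁻ x, convPow f n x = (∫⁻ x, f x) ^ n := by
  induction n, hn using Nat.le_induction with
  | base => rw [pow_one]; rfl
  | succ n hn ih =>
    rw [convPow_succ f hn, lintegral_lconvolution (measurable_convPow hf hn) hf, ih, pow_succ]

/-! ### The density and its convolutions over the half-line -/

lemma measurable_expDensity (m γ : ℝ) : Measurable (expDensity m γ) := by
  unfold expDensity
  fun_prop

lemma isSymmDecreasing_expDensity {m γ : ℝ} (hm : 0 < m) (hγ : 0 ≤ γ) :
    IsSymmDecreasing (expDensity m γ) := by
  intro x y hxy
  unfold expDensity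
  refine mul_le_mul' (ENNReal.ofReal_le_ofReal (Real.exp_le_exp.2 (by nlinarith))) ?_
  rw [ENNReal.rpow_neg, ENNReal.rpow_neg, ENNReal.inv_le_inv]
  exact ENNReal.rpow_le_rpow (ENNReal.ofReal_le_ofReal hxy) hγ

lemma expDensity_of_ne_zero (m γ : ℝ) {x : ℝ} (hx : x ≠ 0) :
    expDensity m γ x = ENNReal.ofReal (|x| ^ (-γ) * Real.exp (-m * |x|)) := by
  have hx' : 0 < |x| := abs_pos.2 hx
  rw [expDensity, ENNReal.ofReal_rpow_of_pos hx', ← ENNReal.ofReal_mul (Real.exp_pos _).le,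
    mul_comm]

lemma lintegral_expDensity_ne_top {m γ : ℝ} (hm : 0 < m) (hγ : γ < 1) :
    ∫⁻ x, expDensity m γ x ≠ ⊤ := by
  have h0 : IntegrableOn (fun x : ℝ => x ^ (-γ) * Real.exp (-m * x ^ (1 : ℝ))) (Set.Ioi 0) :=
    integrableOn_rpow_mul_exp_neg_mul_rpow (by linarith) one_pos hm
  have h1 : ∫⁻ x in Set.Ioi 0, expDensity m γ x < ⊤ := by
    refine lt_of_eq_of_lt (setLIntegral_congr_fun measurableSet_Ioi fun x hx => ?_)
      h0.lintegral_lt_top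
    have hx' : (0 : ℝ) < x := hx
    simp only [expDensity_of_ne_zero m γ hx'.ne', abs_of_pos hx', Real.rpow_one]
  set h : ℝ → ℝ≥0∞ := (Set.Ioi 0).indicator (expDensity m γ) with hh
  have hm' : Measurable h := (measurable_expDensity m γ).indicator measurableSet_Ioi
  have h2 : ∫⁻ x, expDensity m γ x ≤ ∫⁻ x, (h x + h (-x)) := by
    refine lintegral_mono_ae ?_
    filter_upwards [compl_mem_ae_iff.2 (measure_singleton (0 : ℝ))] with x hx
    have hx0 : x ≠ 0 := hx
    rcases lt_or_gt_of_ne hx0 with hlt | hgt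
    · have : h (-x) = expDensity m γ x := by
        rw [hh, Set.indicator_of_mem (show -x ∈ Set.Ioi 0 from neg_pos.2 hlt)]
        simp [expDensity]
      rw [this]
      exact le_add_self
    · have : h x = expDensity m γ x := Set.indicator_of_mem (show x ∈ Set.Ioi 0 from hgt) _
      rw [this]
      exact le_self_add
  rw [lintegral_add_left hm', lintegral_neg_eq_self, hh, lintegral_indicator measurableSet_Ioi]
    at h2
  exact (h2.trans_lt (ENNReal.add_lt_top.2 ⟨h1, h1⟩)).ne

/-- The `k`-fold convolution power, evaluated at `x > 0`, of the restriction of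
`y ↦ exp (-m * y) * y ^ (a - 1)` to the half-line `(0, ∞)`: a multiple of a Gamma density.
For `k = 0` it vanishes, by the convention `1 / Γ(0) = 0`. -/
noncomputable def halfLineConvPow (m a : ℝ) (k : ℕ) (x : ℝ) : ℝ :=
  Real.Gamma a ^ k / Real.Gamma (a * k) * (x ^ (a * k - 1) * Real.exp (-m * x))

lemma halfLineConvPow_zero (m a x : ℝ) : halfLineConvPow m a 0 x = 0 := by
  simp [halfLineConvPow]

lemma halfLineConvPow_nonneg {m a x : ℝ} (ha : 0 < a) (hx : 0 < x) (k : ℕ) :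
    0 ≤ halfLineConvPow m a k x := by
  have h1 : 0 ≤ Real.Gamma (a * k) := Real.Gamma_nonneg_of_nonneg (by positivity)
  have h2 : 0 < Real.Gamma a := Real.Gamma_pos_of_pos ha
  unfold halfLineConvPow
  positivity

lemma measurable_halfLineConvPow (m a : ℝ) (k : ℕ) : Measurable (halfLineConvPow m a k) := by
  unfold halfLineConvPow
  fun_prop

lemma expDensity_eq_halfLineConvPow_one (m : ℝ) {γ x : ℝ} (hγ : γ < 1) (hx : 0 < x) :
    expDensity m γ x = ENNReal.ofReal (halfLineConvPow m (1 - γ) 1 x) := by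
  have hG : Real.Gamma (1 - γ) ≠ 0 := (Real.Gamma_pos_of_pos (by linarith)).ne'
  rw [expDensity_of_ne_zero m γ hx.ne', abs_of_pos hx, halfLineConvPow]
  simp [hG]

/-- Euler's Beta integral over `(0, x)`. -/
lemma lintegral_rpow_mul_sub_rpow {p q x : ℝ} (hp : 0 < p) (hq : 0 < q) (hx : 0 < x) :
    ∫⁻ y in Set.Ioo 0 x, ENNReal.ofReal (y ^ (p - 1) * (x - y) ^ (q - 1)) =
      ENNReal.ofReal
        (Real.Gamma p * Real.Gamma q / Real.Gamma (p + q) * x ^ (p + q - 1)) := by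
  have himage : Set.Ioo 0 x = (fun v => x * v) '' Set.Ioo 0 1 := by
    rw [Set.image_mul_left_Ioo hx]; simp
  have hB : 0 < ProbabilityTheory.beta p q := ProbabilityTheory.beta_pos hp hq
  have hone := ProbabilityTheory.lintegral_betaPDF_eq_one hp hq
  rw [ProbabilityTheory.lintegral_betaPDF] at hone
  rw [himage, lintegral_image_eq_lintegral_abs_deriv_mul (f' := fun _ => x) measurableSet_Ioo
    (fun v _ => by simpa using ((hasDerivAt_id v).const_mul x).hasDerivWithinAt)
    (fun u _ v _ h => mul_left_cancel₀ hx.ne' h)]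
  calc ∫⁻ v in Set.Ioo 0 1, ENNReal.ofReal |x| *
        ENNReal.ofReal ((x * v) ^ (p - 1) * (x - x * v) ^ (q - 1))
      = ∫⁻ v in Set.Ioo 0 1, ENNReal.ofReal (ProbabilityTheory.beta p q * x ^ (p + q - 1)) *
          ENNReal.ofReal (1 / ProbabilityTheory.beta p q * v ^ (p - 1) * (1 - v) ^ (q - 1)) := by
        refine setLIntegral_congr_fun measurableSet_Ioo fun v hv => ?_
        have hv0 : 0 < v := hv.1
        have hv1 : 0 < 1 - v := sub_pos.2 hv.2
        rw [← ENNReal.ofReal_mul (abs_nonneg _), ← ENNReal.ofReal_mul (by positivity),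
          abs_of_pos hx, show x - x * v = x * (1 - v) by ring, Real.mul_rpow hx.le hv0.le,
          Real.mul_rpow hx.le hv1.le, show p + q - 1 = 1 + (p - 1) + (q - 1) by ring,
          Real.rpow_add hx, Real.rpow_add hx, Real.rpow_one]
        congr 1
        field_simp
    _ = ENNReal.ofReal (ProbabilityTheory.beta p q * x ^ (p + q - 1)) := by
        rw [lintegral_const_mul' _ _ ENNReal.ofReal_ne_top, hone, mul_one]
    _ = _ := rfl

lemma lintegral_halfLineConvPow_mul {m γ x : ℝ} (hγ : γ < 1) (hx : 0 < x) {k : ℕ} (hk : 1 ≤ k) :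
    ∫⁻ y in Set.Ioo 0 x, ENNReal.ofReal (halfLineConvPow m (1 - γ) k y) *
        expDensity m γ (-y + x) =
      ENNReal.ofReal (halfLineConvPow m (1 - γ) (k + 1) x) := by
  have ha : 0 < 1 - γ := by linarith
  set a := 1 - γ with haγ
  have hk0 : (0 : ℝ) < k := by exact_mod_cast hk
  have hG : 0 < Real.Gamma a := Real.Gamma_pos_of_pos ha
  have hGk : 0 < Real.Gamma (a * k) := Real.Gamma_pos_of_pos (by positivity)
  calc _ = ∫⁻ y in Set.Ioo 0 x,
        ENNReal.ofReal (Real.Gamma a ^ k / Real.Gamma (a * k) * Real.exp (-m * x)) *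
          ENNReal.ofReal (y ^ (a * k - 1) * (x - y) ^ (a - 1)) := by
        refine setLIntegral_congr_fun measurableSet_Ioo fun y hy => ?_
        have hy0 : 0 < y := hy.1
        have hy1 : 0 < x - y := sub_pos.2 hy.2
        rw [show -y + x = x - y by ring, expDensity_of_ne_zero m γ hy1.ne', abs_of_pos hy1,
          ← ENNReal.ofReal_mul (halfLineConvPow_nonneg ha hy0 k),
          ← ENNReal.ofReal_mul (by positivity), halfLineConvPow,
          show -γ = a - 1 by rw [haγ]; ring,
          show Real.exp (-m * x) = Real.exp (-m * y) * Real.exp (-m * (x - y)) by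
            rw [← Real.exp_add]; ring_nf]
        congr 1
        ring
    _ = _ := by
        rw [lintegral_const_mul' _ _ ENNReal.ofReal_ne_top,
          lintegral_rpow_mul_sub_rpow (by positivity) ha hx,
          ← ENNReal.ofReal_mul (by positivity), halfLineConvPow, Nat.cast_add_one,
          show a * ((k : ℝ) + 1) = a * k + a by ring]
        congr 1
        field_simp
        ring

/-! ### Two-sided bounds for the convolution powers -/

lemma ofReal_halfLineConvPow_le_convPow {m γ x : ℝ} (hγ : γ < 1) (hx : 0 < x) {n : ℕ}
    (hn : 1 ≤ n) :
    ENNReal.ofReal (halfLineConvPow m (1 - γ) n x) ≤ convPow (expDensity m γ) n x := by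
  induction n, hn using Nat.le_induction generalizing x with
  | base => exact (expDensity_eq_halfLineConvPow_one m hγ hx).ge
  | succ n hn ih =>
    rw [convPow_succ _ hn, lconvolution_def, ← lintegral_halfLineConvPow_mul hγ hx hn]
    refine le_trans ?_ (setLIntegral_le_lintegral (Set.Ioo 0 x) _)
    exact setLIntegral_mono' measurableSet_Ioo fun y hy => mul_le_mul_left (ih hy.1) _

/-- The upper bound for `f^{n⋆}(x)`, `x > 0`: a binomial sum in which each of the `n` factors
either contributes to the convolution over the half-line, or only through its mass `‖f‖₁`.
In `∫ f^{n⋆}(y) f(x - y) dy` one has `f(x - y) ≤ f(x)` if `y ≤ 0`, and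
`f^{n⋆}(y) ≤ f^{n⋆}(x)` if `y ≥ x`, as both functions are symmetric decreasing; the induction
hypothesis is needed on `0 < y < x` only, and Pascal's rule puts the three parts together. -/
lemma convPow_le_sum {m γ x : ℝ} (hm : 0 < m) (hγ₀ : 0 ≤ γ) (hγ : γ < 1) (hx : 0 < x) {n : ℕ}
    (hn : 1 ≤ n) :
    convPow (expDensity m γ) n x ≤ ∑ ij ∈ antidiagonal n, (n.choose ij.1 : ℝ≥0∞) *
      (ENNReal.ofReal (halfLineConvPow m (1 - γ) ij.1 x) *
        (∫⁻ z, expDensity m γ z) ^ ij.2) := by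
  induction n, hn using Nat.le_induction generalizing x with
  | base =>
    have h : (convPow (expDensity m γ) 1 x) = expDensity m γ x := rfl
    rw [h, expDensity_eq_halfLineConvPow_one m hγ hx, Finset.Nat.antidiagonal_succ]
    simp [halfLineConvPow_zero]
  | succ n hn ih =>
    have hfm := measurable_expDensity m γ
    have hfs := isSymmDecreasing_expDensity hm hγ₀
    have hFm := measurable_convPow hfm hn
    have hFs := isSymmDecreasing_convPow hfm hfs hn
    set f := expDensity m γ with hf
    set F := convPow f n with hF
    set J := ∫⁻ z, f z with hJ
    set g : ℕ → ℝ → ℝ≥0∞ := fun k y => ENNReal.ofReal (halfLineConvPow m (1 - γ) k y) with hg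
    have hgm : ∀ k, Measurable (g k) := fun k =>
      (measurable_halfLineConvPow m (1 - γ) k).ennreal_ofReal
    have hg0 : ∀ y, g 0 y = 0 := fun y => by simp [hg, halfLineConvPow_zero]
    rw [convPow_succ _ hn, lconvolution_def]
    have hsplit : ∀ y, F y * f (-y + x) ≤
        (Set.Ioo 0 x).indicator (fun y => F y * f (-y + x)) y +
          (F y * f x + F x * f (-y + x)) := by
      intro y
      rcases le_or_gt y 0 with h0 | h0
      · refine le_add_left (le_add_right (mul_le_mul_right (hfs _ _ ?_) _))
        rw [abs_of_pos hx]
        exact le_abs.2 (Or.inl (by linarith))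
      rcases le_or_gt x y with h1 | h1
      · refine le_add_left (le_add_left (mul_le_mul_left (hFs _ _ ?_) _))
        rw [abs_of_pos hx, abs_of_pos h0]
        exact h1
      · rw [Set.indicator_of_mem (show y ∈ Set.Ioo 0 x from ⟨h0, h1⟩)]
        exact le_self_add
    have hmid : ∫⁻ y in Set.Ioo 0 x, F y * f (-y + x) ≤
        ∑ ij ∈ antidiagonal n, (n.choose ij.1 : ℝ≥0∞) *
          ((if ij.1 = 0 then 0 else g (ij.1 + 1) x) * J ^ ij.2) := by
      calc _ ≤ ∫⁻ y in Set.Ioo 0 x, ∑ ij ∈ antidiagonal n,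
            ((n.choose ij.1 : ℝ≥0∞) * J ^ ij.2) * (g ij.1 y * f (-y + x)) := by
            refine setLIntegral_mono' measurableSet_Ioo fun y hy => ?_
            refine (mul_le_mul_left (ih hy.1) _).trans (le_of_eq ?_)
            rw [Finset.sum_mul]
            exact Finset.sum_congr rfl fun ij _ => by ring
        _ = ∑ ij ∈ antidiagonal n, ((n.choose ij.1 : ℝ≥0∞) * J ^ ij.2) *
              ∫⁻ y in Set.Ioo 0 x, g ij.1 y * f (-y + x) := by
            have hgf : ∀ k, Measurable fun y => g k y * f (-y + x) := fun k => by
              have := hgm k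
              fun_prop
            rw [lintegral_finsetSum _ fun ij _ => (hgf ij.1).const_mul _]
            exact Finset.sum_congr rfl fun ij _ => lintegral_const_mul _ (hgf ij.1)
        _ = _ := by
            refine Finset.sum_congr rfl fun ij _ => ?_
            rcases Nat.eq_zero_or_pos ij.1 with h0 | h0
            · simp [h0, hg0]
            · rw [if_neg h0.ne', hg, lintegral_halfLineConvPow_mul hγ hx h0]
              ring
    have hfx : f x = g 1 x := expDensity_eq_halfLineConvPow_one m hγ hx
    -- the part `y ≤ 0` supplies exactly the term that is missing at `k = 0`
    have hmid' : ∑ ij ∈ antidiagonal n, (n.choose ij.1 : ℝ≥0∞) *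
          ((if ij.1 = 0 then 0 else g (ij.1 + 1) x) * J ^ ij.2) + J ^ n * f x =
        ∑ ij ∈ antidiagonal n, (n.choose ij.1 : ℝ≥0∞) * (g (ij.1 + 1) x * J ^ ij.2) := by
      obtain ⟨k, rfl⟩ := Nat.exists_eq_add_of_le' hn
      rw [Finset.Nat.antidiagonal_succ, Finset.sum_cons, Finset.sum_cons, Finset.sum_map,
        Finset.sum_map, hfx]
      simp
      ring
    have hshift : ∫⁻ y, f (-y + x) = J := by
      simp_rw [neg_add_eq_sub]
      exact lintegral_sub_left_eq_self f x
    calc ∫⁻ y, F y * f (-y + x)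
        ≤ ∫⁻ y, ((Set.Ioo 0 x).indicator (fun y => F y * f (-y + x)) y +
          (F y * f x + F x * f (-y + x))) := lintegral_mono hsplit
      _ = (∫⁻ y in Set.Ioo 0 x, F y * f (-y + x)) + (J ^ n * f x + F x * J) := by
          rw [lintegral_add_left ((by fun_prop : Measurable fun y => F y * f (-y + x)).indicator
            measurableSet_Ioo), lintegral_indicator measurableSet_Ioo,
            lintegral_add_left (by fun_prop), lintegral_mul_const _ hFm,
            lintegral_const_mul _ (by fun_prop), hshift, hF, lintegral_convPow hfm hn]
      _ ≤ ∑ ij ∈ antidiagonal n, (n.choose ij.1 : ℝ≥0∞) * (g (ij.1 + 1) x * J ^ ij.2) +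
          (∑ ij ∈ antidiagonal n, (n.choose ij.1 : ℝ≥0∞) * (g ij.1 x * J ^ ij.2)) * J := by
          rw [← add_assoc, ← hmid']
          exact add_le_add (add_le_add_left hmid _) (mul_le_mul_left (ih hx) _)
      _ = _ := by
          rw [Finset.sum_antidiagonal_choose_succ_mul (fun i j => g i x * J ^ j), add_comm,
            Finset.sum_mul]
          congr 1
          · exact Finset.sum_congr rfl fun ij _ => by ring
          · refine Finset.sum_congr rfl fun ij hij => ?_
            rw [Nat.choose_symm_of_eq_add (Finset.HasAntidiagonal.mem_antidiagonal.1 hij).symm]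

lemma normOne_nonneg (f : ℝ → ℝ≥0∞) : 0 ≤ normOne f := ENNReal.toReal_nonneg

lemma convPow_expDensity_abs {m γ : ℝ} (hm : 0 < m) (hγ₀ : 0 ≤ γ) {n : ℕ} (hn : 1 ≤ n) (x : ℝ) :
    convPow (expDensity m γ) n x = convPow (expDensity m γ) n |x| :=
  (isSymmDecreasing_convPow (measurable_expDensity m γ) (isSymmDecreasing_expDensity hm hγ₀)
    hn).eq_of_abs_eq (abs_abs x).symm

lemma convPow_le_ofReal_sum {m γ x : ℝ} (hm : 0 < m) (hγ₀ : 0 ≤ γ) (hγ : γ < 1) (hx : x ≠ 0)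
    {n : ℕ} (hn : 1 ≤ n) :
    convPow (expDensity m γ) n x ≤ ENNReal.ofReal (∑ ij ∈ antidiagonal n, (n.choose ij.1 : ℝ) *
      (halfLineConvPow m (1 - γ) ij.1 |x| * normOne (expDensity m γ) ^ ij.2)) := by
  have hx' : 0 < |x| := abs_pos.2 hx
  have ha : 0 < 1 - γ := by linarith
  have hI := normOne_nonneg (expDensity m γ)
  have hJ : ∫⁻ z, expDensity m γ z = ENNReal.ofReal (normOne (expDensity m γ)) :=
    (ENNReal.ofReal_toReal (lintegral_expDensity_ne_top hm hγ)).symm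
  have h0 := fun k => halfLineConvPow_nonneg (m := m) ha hx' k
  rw [convPow_expDensity_abs hm hγ₀ hn, ENNReal.ofReal_sum_of_nonneg fun ij _ =>
    mul_nonneg (Nat.cast_nonneg _) (mul_nonneg (h0 _) (pow_nonneg hI _))]
  refine (convPow_le_sum hm hγ₀ hγ hx' hn).trans (le_of_eq (Finset.sum_congr rfl fun ij _ => ?_))
  rw [ENNReal.ofReal_mul (Nat.cast_nonneg _), ENNReal.ofReal_natCast,
    ENNReal.ofReal_mul (h0 _), ENNReal.ofReal_pow hI, hJ]

lemma convPow_ne_top {m γ x : ℝ} (hm : 0 < m) (hγ₀ : 0 ≤ γ) (hγ : γ < 1) (hx : x ≠ 0)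
    {n : ℕ} (hn : 1 ≤ n) : convPow (expDensity m γ) n x ≠ ⊤ :=
  ((convPow_le_ofReal_sum hm hγ₀ hγ hx hn).trans_lt ENNReal.ofReal_lt_top).ne

lemma toReal_convPow_le_sum {m γ x : ℝ} (hm : 0 < m) (hγ₀ : 0 ≤ γ) (hγ : γ < 1) (hx : x ≠ 0)
    {n : ℕ} (hn : 1 ≤ n) :
    (convPow (expDensity m γ) n x).toReal ≤ ∑ ij ∈ antidiagonal n, (n.choose ij.1 : ℝ) *
      (halfLineConvPow m (1 - γ) ij.1 |x| * normOne (expDensity m γ) ^ ij.2) := by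
  refine ENNReal.toReal_le_of_le_ofReal (Finset.sum_nonneg fun ij _ => ?_)
    (convPow_le_ofReal_sum hm hγ₀ hγ hx hn)
  exact mul_nonneg (Nat.cast_nonneg _) (mul_nonneg
    (halfLineConvPow_nonneg (by linarith) (abs_pos.2 hx) _) (pow_nonneg (normOne_nonneg _) _))

lemma halfLineConvPow_le_toReal_convPow {m γ x : ℝ} (hm : 0 < m) (hγ₀ : 0 ≤ γ) (hγ : γ < 1)
    (hx : x ≠ 0) {n : ℕ} (hn : 1 ≤ n) :
    halfLineConvPow m (1 - γ) n |x| ≤ (convPow (expDensity m γ) n x).toReal := by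
  rw [← ENNReal.ofReal_le_iff_le_toReal (convPow_ne_top hm hγ₀ hγ hx hn),
    convPow_expDensity_abs hm hγ₀ hn]
  exact ofReal_halfLineConvPow_le_convPow hγ (abs_pos.2 hx) hn

lemma toReal_expDensity_mul_rpow {m γ x : ℝ} (hx : x ≠ 0) (n : ℝ) :
    (expDensity m γ x).toReal * |x| ^ ((1 - γ) * (n - 1)) =
      Real.exp (-m * |x|) * |x| ^ ((1 - γ) * n - 1) := by
  have hx' : 0 < |x| := abs_pos.2 hx
  rw [expDensity_of_ne_zero m γ hx, ENNReal.toReal_ofReal (by positivity),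
    show (1 - γ) * n - 1 = -γ + (1 - γ) * (n - 1) by ring, Real.rpow_add hx']
  ring

lemma add_pow_sub_pow_le {b c : ℝ} (hb : 0 ≤ b) (hc : 0 ≤ c) (n : ℕ) :
    (b + c) ^ (n + 1) - c ^ (n + 1) ≤ (n + 1) * b * (b + c) ^ n := by
  induction n with
  | zero => simp
  | succ n ih =>
    have h1 : c ^ (n + 1) ≤ (b + c) ^ (n + 1) := pow_le_pow_left₀ hc (by linarith) _
    have h2 := mul_le_mul_of_nonneg_left ih (show 0 ≤ b + c by linarith)
    have h3 := mul_le_mul_of_nonneg_left h1 hb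
    calc (b + c) ^ (n + 1 + 1) - c ^ (n + 1 + 1)
        = (b + c) * ((b + c) ^ (n + 1) - c ^ (n + 1)) + b * c ^ (n + 1) := by ring
      _ ≤ (b + c) * ((n + 1) * b * (b + c) ^ n) + b * (b + c) ^ (n + 1) := add_le_add h2 h3
      _ = _ := by push_cast; ring

/-- The main term of the binomial upper bound is the one in which all factors are convolved over
the half-line. -/
lemma sum_halfLineConvPow_le {m a X I : ℝ} (ha : 0 < a) (hX : 1 ≤ X) (hI : 0 ≤ I) {n : ℕ}
    (hn : 1 ≤ n) :
    ∑ ij ∈ antidiagonal n, (n.choose ij.1 : ℝ) * (halfLineConvPow m a ij.1 X * I ^ ij.2) ≤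
      (Real.Gamma a ^ n / Real.Gamma (a * n) +
        2 * I * n * (I + Real.Gamma a) ^ (n - 1) / X ^ a) *
          (Real.exp (-m * X) * X ^ (a * n - 1)) := by
  obtain ⟨k, rfl⟩ := Nat.exists_eq_add_of_le' hn
  have hX0 : 0 < X := by linarith
  have hG : 0 < Real.Gamma a := Real.Gamma_pos_of_pos ha
  set D := Real.exp (-m * X) * X ^ (a * (k + 1 : ℕ) - 1) with hD
  have hD0 : 0 < D := by positivity
  have hterm : ∀ i j : ℕ, i + j = k → halfLineConvPow m a i X ≤
      2 / X ^ a * D * Real.Gamma a ^ i := by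
    intro i j hij
    rcases Nat.eq_zero_or_pos i with rfl | hi
    · rw [halfLineConvPow_zero]; positivity
    have hi0 : (0 : ℝ) < i := by exact_mod_cast hi
    have h1 := half_le_Gamma (s := a * i) (by positivity)
    have h2 : Real.Gamma a ^ i / Real.Gamma (a * i) ≤ 2 * Real.Gamma a ^ i := by
      rw [div_le_iff₀ (by linarith)]
      have : 0 < Real.Gamma a ^ i := by positivity
      nlinarith
    have h3 : X ^ (a * i - 1) ≤ X ^ (a * (k + 1 : ℕ) - 1) / X ^ a := by
      rw [← Real.rpow_sub hX0]
      refine Real.rpow_le_rpow_of_exponent_le hX ?_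
      have : (i : ℝ) ≤ k := by exact_mod_cast (by omega : i ≤ k)
      push_cast
      nlinarith
    calc halfLineConvPow m a i X
        ≤ 2 * Real.Gamma a ^ i * (X ^ (a * (k + 1 : ℕ) - 1) / X ^ a * Real.exp (-m * X)) := by
          unfold halfLineConvPow
          gcongr
      _ = _ := by rw [hD]; ring
  have hpow := (Commute.all (Real.Gamma a) I).add_pow' (k + 1)
  rw [Finset.Nat.antidiagonal_succ', Finset.sum_cons, Finset.sum_map] at hpow ⊢
  simp only [Function.Embedding.coe_prodMap, Prod.map, Function.Embedding.refl_apply,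
    Function.Embedding.coeFn_mk, Nat.choose_self, one_smul, pow_zero, mul_one, nsmul_eq_mul,
    Nat.succ_eq_add_one, Nat.cast_one, one_mul] at hpow ⊢
  have hsum : ∑ ij ∈ antidiagonal k, ((k + 1).choose ij.1 : ℝ) *
      (halfLineConvPow m a ij.1 X * I ^ (ij.2 + 1)) ≤
      2 / X ^ a * D * ((I + Real.Gamma a) ^ (k + 1) - Real.Gamma a ^ (k + 1)) := by
    rw [add_comm I, hpow, add_sub_cancel_left, Finset.mul_sum]
    refine Finset.sum_le_sum fun ij hij => ?_
    have h1 := hterm ij.1 ij.2 (Finset.HasAntidiagonal.mem_antidiagonal.1 hij)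
    calc ((k + 1).choose ij.1 : ℝ) * (halfLineConvPow m a ij.1 X * I ^ (ij.2 + 1))
        ≤ ((k + 1).choose ij.1 : ℝ) *
          (2 / X ^ a * D * Real.Gamma a ^ ij.1 * I ^ (ij.2 + 1)) := by gcongr
      _ = _ := by ring
  have h4 := mul_le_mul_of_nonneg_left (add_pow_sub_pow_le hI hG.le k)
    (show 0 ≤ 2 / X ^ a * D by positivity)
  have h5 : halfLineConvPow m a (k + 1) X =
      Real.Gamma a ^ (k + 1) / Real.Gamma (a * (k + 1 : ℕ)) * D := by
    rw [halfLineConvPow, hD]; ring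
  rw [h5, Nat.add_sub_cancel, add_mul]
  refine add_le_add le_rfl (hsum.trans (h4.trans (le_of_eq ?_)))
  push_cast
  ring

/-- The two-sided bound for the convolution powers, with an arbitrary constant `M ≥ ‖f‖₁`. -/
lemma convPow_ratio_bounds {m γ x M : ℝ} (hm : 0 < m) (hγ₀ : 0 ≤ γ) (hγ : γ < 1) (hx : 1 ≤ |x|)
    (hM : normOne (expDensity m γ) ≤ M) {n : ℕ} (hn : 1 ≤ n) :
    Real.Gamma (1 - γ) ^ n / Real.Gamma ((1 - γ) * n) ≤
        (convPow (expDensity m γ) n x).toReal /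
          ((expDensity m γ x).toReal * |x| ^ ((1 - γ) * ((n : ℝ) - 1))) ∧
      (convPow (expDensity m γ) n x).toReal /
          ((expDensity m γ x).toReal * |x| ^ ((1 - γ) * ((n : ℝ) - 1))) ≤
        Real.Gamma (1 - γ) ^ n / Real.Gamma ((1 - γ) * n) +
          2 * M * n * (M + Real.Gamma (1 - γ)) ^ (n - 1) / |x| ^ (1 - γ) := by
  have hX : 0 < |x| := by linarith
  have hx0 : x ≠ 0 := abs_pos.1 hX
  have ha : 0 < 1 - γ := by linarith
  have hG : 0 < Real.Gamma (1 - γ) := Real.Gamma_pos_of_pos ha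
  have hI := normOne_nonneg (expDensity m γ)
  have hM0 : 0 ≤ M := hI.trans hM
  rw [toReal_expDensity_mul_rpow hx0]
  constructor
  · rw [le_div_iff₀ (by positivity)]
    refine le_of_eq_of_le ?_ (halfLineConvPow_le_toReal_convPow hm hγ₀ hγ hx0 hn)
    rw [halfLineConvPow]
    ring
  · rw [div_le_iff₀ (by positivity)]
    refine (toReal_convPow_le_sum hm hγ₀ hγ hx0 hn).trans
      ((sum_halfLineConvPow_le ha hx hI hn).trans ?_)
    gcongr

lemma tendsto_convPow_ratio {m γ : ℝ} (hm : 0 < m) (hγ₀ : 0 ≤ γ) (hγ : γ < 1) {n : ℕ}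
    (hn : 1 ≤ n) :
    Tendsto (fun x : ℝ => (convPow (expDensity m γ) n x).toReal /
        ((expDensity m γ x).toReal * |x| ^ ((1 - γ) * ((n : ℝ) - 1))))
      (comap (fun x : ℝ => |x|) atTop)
      (𝓝 (Real.Gamma (1 - γ) ^ n / Real.Gamma ((1 - γ) * n))) := by
  have hlim : Tendsto (fun x : ℝ => Real.Gamma (1 - γ) ^ n / Real.Gamma ((1 - γ) * n) +
      2 * normOne (expDensity m γ) * n *
        (normOne (expDensity m γ) + Real.Gamma (1 - γ)) ^ (n - 1) / |x| ^ (1 - γ))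
      (comap (fun x : ℝ => |x|) atTop)
      (𝓝 (Real.Gamma (1 - γ) ^ n / Real.Gamma ((1 - γ) * n))) := by
    have h := (((tendsto_rpow_atTop (show 0 < 1 - γ by linarith)).comp
      (tendsto_comap (f := fun x : ℝ => |x|))).const_div_atTop
      (2 * normOne (expDensity m γ) * n *
        (normOne (expDensity m γ) + Real.Gamma (1 - γ)) ^ (n - 1))).const_add
      (Real.Gamma (1 - γ) ^ n / Real.Gamma ((1 - γ) * n))
    rwa [add_zero] at h
  have hev : ∀ᶠ x : ℝ in comap (fun x : ℝ => |x|) atTop, 1 ≤ |x| :=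
    tendsto_comap.eventually (eventually_ge_atTop (1 : ℝ))
  refine tendsto_of_tendsto_of_tendsto_of_le_of_le' tendsto_const_nhds hlim ?_ ?_
  · filter_upwards [hev] with x hx
    exact (convPow_ratio_bounds hm hγ₀ hγ hx le_rfl hn).1
  · filter_upwards [hev] with x hx
    exact (convPow_ratio_bounds hm hγ₀ hγ hx le_rfl hn).2

/-! ### The compound Poisson density -/

/-- The exponential generating function of the half-line convolution powers is a Wright
function. -/
lemma hasSum_halfLineConvPow {m a X lam : ℝ} (ha : 0 < a) (hX : 0 < X) (hlam : 0 < lam) :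
    HasSum (fun n : ℕ => lam ^ n / (n ! : ℝ) * halfLineConvPow m a n X)
      (Real.exp (-m * X) * X⁻¹ * wright a 0 (Real.Gamma a * lam * X ^ a)) := by
  have ht : 0 < Real.Gamma a * lam * X ^ a := by
    have : 0 < Real.Gamma a := Real.Gamma_pos_of_pos ha
    positivity
  refine ((summable_wright ha ht).hasSum.mul_left (Real.exp (-m * X) * X⁻¹)).congr_fun
    fun n => ?_
  rw [halfLineConvPow, Real.rpow_sub_one hX.ne', Real.rpow_mul_natCast hX.le, add_zero, mul_pow,
    mul_pow]
  ring

/-- The two-sided bound for the compound Poisson density. The exponential generating function of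
the binomial sums that dominate the convolution powers factors into the one for the half-line and
`exp (lam * ‖f‖₁)`. -/
lemma poissonDensity_bounds {m γ x lam : ℝ} (hm : 0 < m) (hγ₀ : 0 ≤ γ) (hγ : γ < 1) (hx : x ≠ 0)
    (hlam : 0 < lam) :
    poissonDensity (expDensity m γ) lam x ≠ ⊤ ∧
    Real.exp (-lam * normOne (expDensity m γ)) * Real.exp (-m * |x|) * |x|⁻¹ *
        wright (1 - γ) 0 (Real.Gamma (1 - γ) * lam * |x| ^ (1 - γ)) ≤
      (poissonDensity (expDensity m γ) lam x).toReal ∧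
    (poissonDensity (expDensity m γ) lam x).toReal ≤
      Real.exp (normOne (expDensity m γ) * lam) *
      (Real.exp (-lam * normOne (expDensity m γ)) * Real.exp (-m * |x|) * |x|⁻¹ *
        wright (1 - γ) 0 (Real.Gamma (1 - γ) * lam * |x| ^ (1 - γ))) := by
  have hX : 0 < |x| := abs_pos.2 hx
  have ha : 0 < 1 - γ := by linarith
  have hI := normOne_nonneg (expDensity m γ)
  set I := normOne (expDensity m γ) with hIdef
  set h : ℕ → ℝ := fun k => halfLineConvPow m (1 - γ) k |x| with hh
  have h0 : ∀ k, 0 ≤ h k := halfLineConvPow_nonneg ha hX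
  set F : ℕ → ℝ := fun n => (convPow (expDensity m γ) n x).toReal with hF
  set W := Real.exp (-m * |x|) * |x|⁻¹ *
    wright (1 - γ) 0 (Real.Gamma (1 - γ) * lam * |x| ^ (1 - γ)) with hW
  have hsumh : HasSum (fun n : ℕ => lam ^ n / (n ! : ℝ) * h n) W :=
    hasSum_halfLineConvPow ha hX hlam
  have hexp : HasSum (fun n : ℕ => (lam * I) ^ n / (n ! : ℝ)) (Real.exp (lam * I)) := by
    rw [Real.exp_eq_exp_ℝ]
    exact NormedSpace.expSeries_div_hasSum_exp _
  set d : ℕ → ℝ := fun n => ∑ ij ∈ antidiagonal n,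
    (lam ^ ij.1 / (ij.1 ! : ℝ) * h ij.1) * ((lam * I) ^ ij.2 / (ij.2 ! : ℝ)) with hd
  have hn1 : Summable fun n : ℕ => ‖lam ^ n / (n ! : ℝ) * h n‖ := hsumh.summable.norm
  have hn2 : Summable fun n : ℕ => ‖(lam * I) ^ n / (n ! : ℝ)‖ := hexp.summable.norm
  have hds : Summable d := (summable_norm_sum_mul_antidiagonal_of_summable_norm hn1 hn2).of_norm
  have hdsum : ∑' n, d n = W * Real.exp (lam * I) := by
    rw [hd, ← tsum_mul_tsum_eq_tsum_sum_antidiagonal_of_summable_norm hn1 hn2, hsumh.tsum_eq,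
      hexp.tsum_eq]
  have hd0 : d 0 = 0 := by simp [hd, hh, halfLineConvPow_zero]
  have hFd : ∀ n : ℕ, lam ^ (n + 1) / ((n + 1)! : ℝ) * F (n + 1) ≤ d (n + 1) := by
    intro n
    refine (mul_le_mul_of_nonneg_left (toReal_convPow_le_sum hm hγ₀ hγ hx (Nat.le_add_left 1 n))
      (by positivity)).trans (le_of_eq ?_)
    rw [Finset.mul_sum]
    refine Finset.sum_congr rfl fun ij hij => ?_
    have hij' := Finset.HasAntidiagonal.mem_antidiagonal.1 hij
    simp only [hh]
    rw [← hij', Nat.choose_symm_add, Nat.add_choose,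
      Nat.cast_div (Nat.factorial_mul_factorial_dvd_factorial_add _ _)
      (by positivity), pow_add, mul_pow, ← hIdef]
    push_cast
    have e1 : ((ij.1 + ij.2)! : ℝ) ≠ 0 := by positivity
    have e2 : (ij.1 ! : ℝ) ≠ 0 := by positivity
    have e3 : (ij.2 ! : ℝ) ≠ 0 := by positivity
    field_simp
  have hhF : ∀ n : ℕ, lam ^ (n + 1) / ((n + 1)! : ℝ) * h (n + 1) ≤
      lam ^ (n + 1) / ((n + 1)! : ℝ) * F (n + 1) := fun n =>
    mul_le_mul_of_nonneg_left (halfLineConvPow_le_toReal_convPow hm hγ₀ hγ hx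
      (Nat.le_add_left 1 n)) (by positivity)
  have hF0 : ∀ n : ℕ, 0 ≤ lam ^ (n + 1) / ((n + 1)! : ℝ) * F (n + 1) := fun n =>
    mul_nonneg (by positivity) ENNReal.toReal_nonneg
  have hds' : Summable fun n => d (n + 1) := (summable_nat_add_iff 1).2 hds
  have hFs : Summable fun n : ℕ => lam ^ (n + 1) / ((n + 1)! : ℝ) * F (n + 1) :=
    Summable.of_nonneg_of_le hF0 hFd hds'
  have hup : ∑' n : ℕ, lam ^ (n + 1) / ((n + 1)! : ℝ) * F (n + 1) ≤ W * Real.exp (lam * I) := by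
    refine (hFs.tsum_le_tsum hFd hds').trans (le_of_eq ?_)
    rw [← hdsum, hds.tsum_eq_zero_add, hd0, zero_add]
  have hlow : W ≤ ∑' n : ℕ, lam ^ (n + 1) / ((n + 1)! : ℝ) * F (n + 1) := by
    have hs' : Summable fun n : ℕ => lam ^ (n + 1) / ((n + 1)! : ℝ) * h (n + 1) :=
      (summable_nat_add_iff (f := fun n : ℕ => lam ^ n / (n ! : ℝ) * h n) 1).2 hsumh.summable
    refine le_of_eq_of_le ?_ (hs'.tsum_le_tsum hhF hFs)
    rw [← hsumh.tsum_eq, hsumh.summable.tsum_eq_zero_add]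
    simp [hh, halfLineConvPow_zero]
  have hpd : poissonDensity (expDensity m γ) lam x = ENNReal.ofReal (Real.exp (-lam * I) *
      ∑' n : ℕ, lam ^ (n + 1) / ((n + 1)! : ℝ) * F (n + 1)) := by
    rw [poissonDensity, ENNReal.ofReal_mul (Real.exp_pos _).le,
      ENNReal.ofReal_tsum_of_nonneg hF0 hFs]
    congr 1
    refine tsum_congr fun n => ?_
    rw [ENNReal.ofReal_mul (by positivity), hF,
      ENNReal.ofReal_toReal (convPow_ne_top hm hγ₀ hγ hx (Nat.le_add_left 1 n))]
  rw [hpd, ENNReal.toReal_ofReal (mul_nonneg (Real.exp_pos _).le (tsum_nonneg hF0))]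
  refine ⟨ENNReal.ofReal_ne_top, ?_, ?_⟩
  · rw [mul_assoc (Real.exp (-lam * I)), mul_assoc (Real.exp (-lam * I)), ← hW]
    exact mul_le_mul_of_nonneg_left hlow (Real.exp_pos _).le
  · rw [mul_assoc (Real.exp (-lam * I)), mul_assoc (Real.exp (-lam * I)), ← hW, mul_comm I lam]
    calc _ ≤ Real.exp (-lam * I) * (W * Real.exp (lam * I)) :=
          mul_le_mul_of_nonneg_left hup (Real.exp_pos _).le
      _ = _ := by ring

lemma rpow_neg_eq_inv_mul {γ X : ℝ} (hX : 0 < X) : X ^ (-γ) = X⁻¹ * X ^ (1 - γ) := by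
  rw [show -γ = -1 + (1 - γ) by ring, Real.rpow_add hX, Real.rpow_neg_one]

/-- The exponent of the Wright function at `t = Γ(1 - γ) s`. -/
lemma wrightExponent_Gamma_mul {γ s : ℝ} (hγ : γ < 1) :
    wrightExponent (1 - γ) (Real.Gamma (1 - γ) * s) =
      (2 - γ) / (1 - γ) * (Real.Gamma (2 - γ) * s) ^ (1 / (2 - γ)) := by
  have ha : 1 - γ ≠ 0 := by linarith
  have h := Real.Gamma_add_one ha
  rw [wrightExponent, show 1 + (1 - γ) = 2 - γ by ring, ← mul_assoc, ← h,
    show 1 - γ + 1 = 2 - γ by ring]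

lemma one_le_wrightExponent {γ s : ℝ} (hγ₀ : 0 ≤ γ) (hγ : γ < 1) (hs : 1 ≤ s) :
    1 ≤ wrightExponent (1 - γ) (Real.Gamma (1 - γ) * s) := by
  rw [wrightExponent_Gamma_mul hγ]
  have hG := half_le_Gamma (s := 2 - γ) (by linarith)
  have h1 : 1 / 2 ≤ Real.Gamma (2 - γ) * s := by nlinarith
  have h2 : (1 / 2 : ℝ) ≤ (Real.Gamma (2 - γ) * s) ^ (1 / (2 - γ)) := by
    calc (1 / 2 : ℝ) = (1 / 2 : ℝ) ^ (1 : ℝ) := (Real.rpow_one _).symm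
      _ ≤ (1 / 2 : ℝ) ^ (1 / (2 - γ)) :=
          Real.rpow_le_rpow_of_exponent_ge (by norm_num) (by norm_num)
            (by rw [div_le_one (by linarith)]; linarith)
      _ ≤ _ := Real.rpow_le_rpow (by norm_num) h1 (by apply div_nonneg <;> linarith)
  have h3 : 2 ≤ (2 - γ) / (1 - γ) := by rw [le_div_iff₀ (by linarith)]; linarith
  nlinarith

/-- The constant relating `√w` to `s ^ (1 / (4 - 2 * γ))`, for `w` the exponent of the Wright
function at `t = Γ(1 - γ) s`. -/
noncomputable def sqrtExponentConst (γ : ℝ) : ℝ :=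
  √((2 - γ) / (1 - γ)) * Real.Gamma (2 - γ) ^ (1 / (4 - 2 * γ))

lemma sqrtExponentConst_pos {γ : ℝ} (hγ : γ < 1) : 0 < sqrtExponentConst γ := by
  have h1 : 0 < Real.Gamma (2 - γ) := Real.Gamma_pos_of_pos (by linarith)
  have h2 : 0 < (2 - γ) / (1 - γ) := div_pos (by linarith) (by linarith)
  unfold sqrtExponentConst
  positivity

lemma sqrt_wrightExponent {γ s : ℝ} (hγ : γ < 1) (hs : 0 < s) :
    √(wrightExponent (1 - γ) (Real.Gamma (1 - γ) * s)) =
      sqrtExponentConst γ * s ^ (1 / (4 - 2 * γ)) := by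
  have h1 : 0 < Real.Gamma (2 - γ) := Real.Gamma_pos_of_pos (by linarith)
  have h2 : 0 < (2 - γ) / (1 - γ) := div_pos (by linarith) (by linarith)
  have h3 : 2 - γ ≠ 0 := by linarith
  have h4 : 4 - 2 * γ ≠ 0 := by linarith
  rw [wrightExponent_Gamma_mul hγ, Real.sqrt_mul h2.le, sqrtExponentConst, mul_assoc,
    ← Real.mul_rpow h1.le hs.le, Real.sqrt_eq_rpow ((Real.Gamma (2 - γ) * s) ^ _),
    ← Real.rpow_mul (by positivity)]
  congr 2
  field_simp
  ring

/-- The comparison function for `1 ≤ lam * X ^ (1 - γ)`, in terms of the exponent `w` of the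
Wright function. -/
lemma large_comparison_eq {m γ X lam I : ℝ} (hγ : γ < 1) (hX : 0 < X) (hlam : 0 < lam) :
    sqrtExponentConst γ * (lam ^ (1 / (4 - 2 * γ)) * X ^ (-((3 - γ) / (4 - 2 * γ))) *
      Real.exp (-lam * I - m * X +
        (2 - γ) / (1 - γ) * (Real.Gamma (2 - γ) * lam * X ^ (1 - γ)) ^ (1 / (2 - γ)))) =
      Real.exp (-lam * I) * Real.exp (-m * X) * X⁻¹ *
        (√(wrightExponent (1 - γ) (Real.Gamma (1 - γ) * (lam * X ^ (1 - γ)))) *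
          Real.exp (wrightExponent (1 - γ) (Real.Gamma (1 - γ) * (lam * X ^ (1 - γ))))) := by
  have h4 : 4 - 2 * γ ≠ 0 := by linarith
  have h5 : -((3 - γ) / (4 - 2 * γ)) = -1 + (1 - γ) * (1 / (4 - 2 * γ)) := by
    rw [div_eq_mul_one_div]
    linear_combination -mul_one_div_cancel h4
  have hexp : Real.exp (-lam * I - m * X) = Real.exp (-lam * I) * Real.exp (-m * X) := by
    rw [← Real.exp_add]; ring_nf
  rw [sqrt_wrightExponent hγ (by positivity), wrightExponent_Gamma_mul hγ,
    Real.mul_rpow hlam.le (by positivity), ← Real.rpow_mul hX.le, Real.exp_add, hexp,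
    ← mul_assoc (Real.Gamma (2 - γ)), h5,
    Real.rpow_add hX, Real.rpow_neg_one]
  ring

end ExpDensity

theorem theorem4p3 (γ : ℝ) (hγ₀ : 0 ≤ γ) (hγ₁ : γ < 1) :
    -- the constants `E₁`, `E₃`, `E₄` depend only on `γ`, while `E₂` depends only on `γ` and `m`
    ∃ E₁ > (0 : ℝ), ∃ E₃ > (0 : ℝ), ∃ E₄ > (0 : ℝ), ∀ m > (0 : ℝ), ∃ E₂ > (0 : ℝ),
      -- `f` is integrable, and the convolutions and `p_lam` are finite for `|x| ≥ 1`
      (∫⁻ x, ExpDensity.expDensity m γ x ≠ ⊤) ∧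
      (∀ n : ℕ, 1 ≤ n → ∀ x : ℝ, 1 ≤ |x| →
        ExpDensity.convPow (ExpDensity.expDensity m γ) n x ≠ ⊤) ∧
      (∀ lam > (0 : ℝ), ∀ x : ℝ, 1 ≤ |x| →
        ExpDensity.poissonDensity (ExpDensity.expDensity m γ) lam x ≠ ⊤) ∧
      -- the limits as `|x| → ∞`
      (∀ n : ℕ, 1 ≤ n →
        Tendsto (fun x : ℝ => (ExpDensity.convPow (ExpDensity.expDensity m γ) n x).toReal /
            ((ExpDensity.expDensity m γ x).toReal * |x| ^ ((1 - γ) * ((n : ℝ) - 1))))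
          (comap (fun x : ℝ => |x|) atTop)
          (𝓝 (Real.Gamma (1 - γ) ^ n / Real.Gamma ((1 - γ) * n))) ∧
        Tendsto (fun x : ℝ => (ExpDensity.convPow (ExpDensity.expDensity m γ) n x).toReal /
            (Real.exp (-m * |x|) * |x| ^ ((1 - γ) * (n : ℝ) - 1)))
          (comap (fun x : ℝ => |x|) atTop)
          (𝓝 (Real.Gamma (1 - γ) ^ n / Real.Gamma ((1 - γ) * n)))) ∧
      ∀ C₁ C₂ : ℝ, ExpDensity.SlowDecayWith (ExpDensity.expDensity m γ) C₁ →
        ExpDensity.DoublingAtZeroWith (ExpDensity.expDensity m γ) C₂ →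
        -- the two-sided bound for convolutions
        (∀ n : ℕ, 1 ≤ n → ∀ x : ℝ, 1 ≤ |x| →
          Real.Gamma (1 - γ) ^ n / Real.Gamma ((1 - γ) * n) ≤
            (ExpDensity.convPow (ExpDensity.expDensity m γ) n x).toReal /
              ((ExpDensity.expDensity m γ x).toReal * |x| ^ ((1 - γ) * ((n : ℝ) - 1))) ∧
          (ExpDensity.convPow (ExpDensity.expDensity m γ) n x).toReal /
              ((ExpDensity.expDensity m γ x).toReal * |x| ^ ((1 - γ) * ((n : ℝ) - 1))) ≤
            Real.Gamma (1 - γ) ^ n / Real.Gamma ((1 - γ) * n) +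
              2 * ExpDensity.M₂ (ExpDensity.expDensity m γ) C₁ C₂ * n *
                (ExpDensity.M₂ (ExpDensity.expDensity m γ) C₁ C₂ + Real.Gamma (1 - γ)) ^ (n - 1) /
                |x| ^ (1 - γ)) ∧
        -- the two-sided bounds for the compound Poisson density
        ∀ lam > (0 : ℝ), ∀ x : ℝ, 1 ≤ |x| →
          (1 ≤ (ExpDensity.poissonDensity (ExpDensity.expDensity m γ) lam x).toReal /
              (Real.exp (-lam * ExpDensity.normOne (ExpDensity.expDensity m γ)) *
                Real.exp (-m * |x|) * |x|⁻¹ *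
                ExpDensity.wright (1 - γ) 0 (Real.Gamma (1 - γ) * lam * |x| ^ (1 - γ))) ∧
            (ExpDensity.poissonDensity (ExpDensity.expDensity m γ) lam x).toReal /
              (Real.exp (-lam * ExpDensity.normOne (ExpDensity.expDensity m γ)) *
                Real.exp (-m * |x|) * |x|⁻¹ *
                ExpDensity.wright (1 - γ) 0 (Real.Gamma (1 - γ) * lam * |x| ^ (1 - γ))) ≤
              Real.exp (ExpDensity.M₂ (ExpDensity.expDensity m γ) C₁ C₂ * lam)) ∧
          (lam * |x| ^ (1 - γ) ≤ 1 →
            E₁ ≤ (ExpDensity.poissonDensity (ExpDensity.expDensity m γ) lam x).toReal /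
              (lam * Real.exp (-lam * ExpDensity.normOne (ExpDensity.expDensity m γ)) *
                Real.exp (-m * |x|) * |x| ^ (-γ)) ∧
            (ExpDensity.poissonDensity (ExpDensity.expDensity m γ) lam x).toReal /
              (lam * Real.exp (-lam * ExpDensity.normOne (ExpDensity.expDensity m γ)) *
                Real.exp (-m * |x|) * |x| ^ (-γ)) ≤ E₂) ∧
          (1 ≤ lam * |x| ^ (1 - γ) →
            E₃ ≤ (ExpDensity.poissonDensity (ExpDensity.expDensity m γ) lam x).toReal /
              (lam ^ (1 / (4 - 2 * γ)) * |x| ^ (-((3 - γ) / (4 - 2 * γ))) *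
                Real.exp (-lam * ExpDensity.normOne (ExpDensity.expDensity m γ) - m * |x| +
                  (2 - γ) / (1 - γ) *
                    (Real.Gamma (2 - γ) * lam * |x| ^ (1 - γ)) ^ (1 / (2 - γ)))) ∧
            (ExpDensity.poissonDensity (ExpDensity.expDensity m γ) lam x).toReal /
              (lam ^ (1 / (4 - 2 * γ)) * |x| ^ (-((3 - γ) / (4 - 2 * γ))) *
                Real.exp (-lam * ExpDensity.normOne (ExpDensity.expDensity m γ) - m * |x| +
                  (2 - γ) / (1 - γ) *
                    (Real.Gamma (2 - γ) * lam * |x| ^ (1 - γ)) ^ (1 / (2 - γ)))) ≤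
              E₄ * Real.exp (ExpDensity.M₂ (ExpDensity.expDensity m γ) C₁ C₂ * lam)) := by
  have ha : 0 < 1 - γ := by linarith
  have ha1 : 1 - γ ≤ 1 := by linarith
  have hκ := ExpDensity.sqrtExponentConst_pos hγ₁
  set κ := ExpDensity.sqrtExponentConst γ with hκdef
  set K := 9 + 2 * |Real.log (1 - γ)| with hK
  set G := Real.Gamma (1 - γ) with hG
  refine ⟨1, one_pos, κ * Real.exp (-K - 16), by positivity, κ * (4 * Real.exp (K + 2)),
    by positivity, fun m hm => ?_⟩
  set f := ExpDensity.expDensity m γ with hf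
  set I := ExpDensity.normOne f with hI
  have hI0 : 0 ≤ I := ExpDensity.normOne_nonneg f
  have hne : ∀ x : ℝ, 1 ≤ |x| → x ≠ 0 := fun x hx => abs_pos.1 (by linarith)
  refine ⟨2 * Real.exp G * Real.exp I, by positivity,
    ExpDensity.lintegral_expDensity_ne_top hm hγ₁,
    fun n hn x hx => ExpDensity.convPow_ne_top hm hγ₀ hγ₁ (hne x hx) hn,
    fun lam hlam x hx => (ExpDensity.poissonDensity_bounds hm hγ₀ hγ₁ (hne x hx) hlam).1,
    fun n hn => ?_, fun C₁ C₂ hC₁ _ => ?_⟩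
  · have h := ExpDensity.tendsto_convPow_ratio hm hγ₀ hγ₁ hn
    refine ⟨h, h.congr' ?_⟩
    filter_upwards [tendsto_comap.eventually (eventually_ge_atTop (1 : ℝ))] with x hx
    rw [ExpDensity.toReal_expDensity_mul_rpow (hne x hx)]
  have hM : I ≤ ExpDensity.M₂ f C₁ C₂ :=
    le_mul_of_one_le_left hI0 (hC₁.1.trans (le_max_left _ _))
  refine ⟨fun n hn x hx => ExpDensity.convPow_ratio_bounds hm hγ₀ hγ₁ hx hM hn,
    fun lam hlam x hx => ?_⟩
  set M := ExpDensity.M₂ f C₁ C₂ with hMdef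
  have hX : 0 < |x| := by linarith
  obtain ⟨-, hlow, hup⟩ := ExpDensity.poissonDensity_bounds hm hγ₀ hγ₁ (hne x hx) hlam
  rw [mul_assoc (Real.Gamma (1 - γ))] at hlow hup
  rw [mul_assoc G]
  set s := lam * |x| ^ (1 - γ) with hs
  have hs0 : 0 < s := by positivity
  obtain ⟨hW1, hW2⟩ := ExpDensity.wright_Gamma_mul_bounds ha hs0
  set W := ExpDensity.wright (1 - γ) 0 (G * s) with hW
  have hW0 : 0 < W := hs0.trans_le hW1
  set A := Real.exp (-lam * I) * Real.exp (-m * |x|) * |x|⁻¹ with hA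
  have hA0 : 0 < A := by positivity
  set p := (ExpDensity.poissonDensity f lam x).toReal with hp
  have hIM : Real.exp (I * lam) ≤ Real.exp (M * lam) :=
    Real.exp_le_exp.2 (mul_le_mul_of_nonneg_right hM hlam.le)
  refine ⟨⟨?_, ?_⟩, fun hs1 => ?_, fun hs1 => ?_⟩
  · rw [one_le_div (by positivity)]
    exact hlow
  · rw [div_le_iff₀ (by positivity)]
    exact hup.trans (mul_le_mul_of_nonneg_right hIM (by positivity))
  · have hD : lam * Real.exp (-lam * I) * Real.exp (-m * |x|) * |x| ^ (-γ) = A * s := by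
      rw [ExpDensity.rpow_neg_eq_inv_mul hX, hA, hs]
      ring
    rw [hD]
    have hlam1 : lam ≤ 1 :=
      (le_mul_of_one_le_right hlam.le (Real.one_le_rpow hx ha.le)).trans hs1
    constructor
    · rw [one_le_div (by positivity)]
      exact (mul_le_mul_of_nonneg_left hW1 hA0.le).trans hlow
    · rw [div_le_iff₀ (by positivity)]
      have h1 : Real.exp (I * lam) ≤ Real.exp I :=
        Real.exp_le_exp.2 (mul_le_of_le_one_right hI0 hlam1)
      calc p ≤ Real.exp (I * lam) * (A * W) := hup
        _ ≤ Real.exp I * (A * (2 * Real.exp G * s)) := by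
            gcongr
            exact hW2 hs1
        _ = _ := by ring
  · have hw := ExpDensity.one_le_wrightExponent hγ₀ hγ₁ hs1
    have hGs : 0 < G * s := mul_pos (Real.Gamma_pos_of_pos ha) hs0
    have h1 := ExpDensity.le_wright ha ha1 hGs hw
    have h2 := ExpDensity.wright_le ha ha1 hGs hw
    have hD := ExpDensity.large_comparison_eq (m := m) (I := I) hγ₁ hX hlam
    set D := lam ^ (1 / (4 - 2 * γ)) * |x| ^ (-((3 - γ) / (4 - 2 * γ))) *
      Real.exp (-lam * I - m * |x| +
        (2 - γ) / (1 - γ) * (Real.Gamma (2 - γ) * lam * |x| ^ (1 - γ)) ^ (1 / (2 - γ))) with hDdef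
    have hD0 : 0 < D := by positivity
    set V := √(ExpDensity.wrightExponent (1 - γ) (G * s)) *
      Real.exp (ExpDensity.wrightExponent (1 - γ) (G * s)) with hV
    have hD' : κ * D = A * V := hD
    constructor
    · rw [le_div_iff₀ hD0]
      calc κ * Real.exp (-K - 16) * D = A * (Real.exp (-K - 16) * V) := by
            rw [mul_right_comm, hD']; ring
        _ ≤ A * W := mul_le_mul_of_nonneg_left h1 hA0.le
        _ ≤ p := hlow
    · rw [div_le_iff₀ hD0]
      calc p ≤ Real.exp (I * lam) * (A * W) := hup
        _ ≤ Real.exp (M * lam) * (A * (4 * Real.exp (K + 2) * V)) := by gcongr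
        _ = κ * D * (4 * Real.exp (K + 2) * Real.exp (M * lam)) := by rw [hD']; ring
        _ = _ := by ring
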